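/- Let $\mathfrak{gl}_\infty$ be the complex Lie algebra, under the commutator bracket, of all matrices $(a_{ij})_{i,j\in\mathbb Z}$ with only finitely many nonzero entries; it has basis the matrix units $E_{m,n}$ $(m,n\in\mathbb Z)$. Put $H=\mathrm{span}\{E_{n,n}\mid n\in\mathbb Z\}$. A $\mathfrak{gl}_\infty$-module $W$ over $\mathbb C$ is *integrable* if every $E_{n,n}$ acts semisimply (i.e. diagonalizably) on $W$ and every $E_{p,q}$ with $p\neq q$ acts locally nilpotently on $W$. Let $\mathcal C$ be the category of $\mathfrak{gl}_\infty$-modules $W$ such that for every $w\in W$ there is a finite set $T\subset\mathbb Z$ with $E_{m,n}w=0$ for all $m,n\in\mathbb Z$ with $n\notin T$, and let $\mathcal C_{int}$ be the full subcategory of integrable modules in $\mathcal C$. For a finite nonempty set $S\subset\mathbb Z$ put $\mathfrak{gl}_S=\mathrm{span}\{E_{m,n}\mid m,n\in S\}$ and $\mathfrak{gl}_\infty^{(S,+)}=\mathrm{span}\{E_{m,n}\mid m\in\mathbb Z,\ n\notin S\}$. For $\lambda\in H^*$ with $\lambda(E_{i,i})=0$ for all $i\notin S$, let $L(\lambda_S)$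 be the irreducible quotient of the Verma $\mathfrak{gl}_S$-module with highest weight $\lambda_S=\lambda|_{H\cap\mathfrak{gl}_S}$ (with respect to the positive part $\mathrm{span}\{E_{m,n}\mid m,n\in S,\ m<n\}$). Let $\mathfrak{gl}_\infty^{(S,+)}$ act on $L(\lambda_S)$ by zero, form the induced module $$M(S,L(\lambda_S))=U(\mathfrak{gl}_\infty)\otimes_{U(\mathfrak{gl}_\infty^{(S,+)}+\mathfrak{gl}_S)}L(\lambda_S),$$ and let $L(S,\lambda)$ be its irreducible quotient, i.e. its quotient by the sum of all its proper submodules. Let $P_+(S)$ be the set of $\lambda\in H^*$ such that $\lambda(E_{i,i})\in\mathbb N=\{0,1,2,\dots\}$ for all $i\in\mathbb Z$, $\lambda(E_{i,i})=0$ for $i\notin S$, and $\lambda(E_{i,i})\ge\lambda(E_{j,j})$ for all $i,j\in S$ with $i<j$. **Theorem.** (1) Let $S=\{r,r+1,\dots,n\}$ where $r<n$ are integers, and let $\lambda\in P_+(S)$. Then $L(S,\lambda)$ is irreducible and belongs to $\mathcal C_{int}$. (2) Every irreducible $\mathfrak{gl}_\infty$-module in $\mathcal C_{int}$ is isomorphic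 to $L(S,\lambda)$ for some $S=\{r,r+1,\dots,n\}$ with integers $r<n$ and some $\lambda\in P_+(S)$. -/

import Mathlib

open scoped TensorProduct

noncomputable section

namespace GlInf

/-! ### The Lie algebra `gl_∞` -/

section Algebra

attribute [local instance 100] LieRing.ofAssociativeRing

/-- `ℂ^∞`: doubly infinite column vectors with finitely many nonzero entries. -/
abbrev CInf : Type := ℤ →₀ ℂ

/-- The matrix unit with a single nonzero entry `1` in position `(m, n)`, as the operator
`v_k ↦ δ_{n,k} v_m` on `ℂ^∞`. -/
def matUnit (m n : ℤ) : Module.End ℂ CInf :=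
  (Finsupp.lsingle m : ℂ →ₗ[ℂ] CInf) ∘ₗ (Finsupp.lapply n : CInf →ₗ[ℂ] ℂ)

lemma matUnit_mul (m n r s : ℤ) :
    matUnit m n * matUnit r s = if n = r then matUnit m s else 0 := by
  ext k l
  by_cases h : n = r
  · subst h
    simp [matUnit]
  · simp [matUnit, h, Finsupp.single_apply]

lemma matUnit_comm (m n r s : ℤ) :
    matUnit m n * matUnit r s - matUnit r s * matUnit m n =
      (if n = r then matUnit m s else 0) - (if m = s then matUnit r n else 0) := by
  rw [matUnit_mul, matUnit_mul]
  simp only [eq_comm]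

/-- If brackets of elements of a generating set lie in its span, then the span is closed under
the bracket. -/
lemma lie_mem_span {g : Type*} [LieRing g] [LieAlgebra ℂ g] {s : Set g}
    (h : ∀ x ∈ s, ∀ y ∈ s, ⁅x, y⁆ ∈ Submodule.span ℂ s) {x y : g}
    (hx : x ∈ Submodule.span ℂ s) (hy : y ∈ Submodule.span ℂ s) :
    ⁅x, y⁆ ∈ Submodule.span ℂ s := by
  induction hx, hy using Submodule.span_induction₂ with
  | mem_mem x y hx hy => exact h x hx y hy
  | zero_left y hy => simp
  | zero_right x hx => simp
  | add_left x y z _ _ _ h₁ h₂ => rw [add_lie]; exact add_mem h₁ h₂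
  | add_right x y z _ _ _ h₁ h₂ => rw [lie_add]; exact add_mem h₁ h₂
  | smul_left c x y _ _ h₁ => rw [smul_lie]; exact Submodule.smul_mem _ _ h₁
  | smul_right c x y _ _ h₁ => rw [lie_smul]; exact Submodule.smul_mem _ _ h₁

/-- `gl_∞`: the doubly infinite complex matrices with finitely many nonzero entries (the span of
the matrix units), under the commutator bracket. -/
def glInf : LieSubalgebra ℂ (Module.End ℂ CInf) where
  toSubmodule := Submodule.span ℂ {x | ∃ m n : ℤ, x = matUnit m n}
  lie_mem' := by
    intro x y hx hy
    refine lie_mem_span ?_ hx hy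
    rintro _ ⟨m, n, rfl⟩ _ ⟨r, s, rfl⟩
    rw [LieRing.of_associative_ring_bracket, matUnit_comm]
    refine Submodule.sub_mem _ ?_ ?_ <;> split_ifs
    · exact Submodule.subset_span ⟨_, _, rfl⟩
    · exact Submodule.zero_mem _
    · exact Submodule.subset_span ⟨_, _, rfl⟩
    · exact Submodule.zero_mem _

/-- The canonical basis vectors `E_{m,n}` of `gl_∞`. -/
def E (m n : ℤ) : glInf := ⟨matUnit m n, Submodule.subset_span ⟨m, n, rfl⟩⟩

lemma lie_E (m n r s : ℤ) :
    ⁅E m n, E r s⁆ = (if n = r then E m s else 0) - (if m = s then E r n else 0) := by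
  apply Subtype.ext
  change matUnit m n * matUnit r s - matUnit r s * matUnit m n = _
  rw [matUnit_comm]
  split_ifs <;> rfl

end Algebra

/-- The Cartan subalgebra `H = span {E_{n,n}}`. -/
def H : Submodule ℂ glInf := Submodule.span ℂ {x | ∃ n : ℤ, x = E n n}

/-- `E_{n,n}` as an element of `H`. -/
def EH (n : ℤ) : H := ⟨E n n, Submodule.subset_span ⟨n, rfl⟩⟩

/-- `gl_S = span {E_{m,n} | m, n ∈ S}`. -/
def glS (S : Finset ℤ) : LieSubalgebra ℂ glInf where
  toSubmodule := Submodule.span ℂ {x | ∃ m ∈ S, ∃ n ∈ S, x = E m n}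
  lie_mem' := by
    intro x y hx hy
    refine lie_mem_span ?_ hx hy
    rintro _ ⟨m, hm, n, hn, rfl⟩ _ ⟨r, hr, s, hs, rfl⟩
    rw [lie_E]
    refine Submodule.sub_mem _ ?_ ?_ <;> split_ifs
    · exact Submodule.subset_span ⟨_, hm, _, hs, rfl⟩
    · exact Submodule.zero_mem _
    · exact Submodule.subset_span ⟨_, hr, _, hn, rfl⟩
    · exact Submodule.zero_mem _

/-- `E_{m,n}` as an element of `gl_S`, for `m, n ∈ S`. -/
def ES {S : Finset ℤ} {m n : ℤ} (hm : m ∈ S) (hn : n ∈ S) : glS S :=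
  ⟨E m n, Submodule.subset_span ⟨m, hm, n, hn, rfl⟩⟩

/-- `gl_∞^{(S,+)} = span {E_{m,n} | m ∈ ℤ, n ∉ S}`. -/
def glPlus (S : Finset ℤ) : Submodule ℂ glInf :=
  Submodule.span ℂ {x | ∃ m n : ℤ, n ∉ S ∧ x = E m n}

/-! ### Categories of `gl_∞`-modules -/

section Categories

variable (W : Type*) [AddCommGroup W] [Module ℂ W] [LieRingModule glInf W] [LieModule ℂ glInf W]

/-- `W` belongs to the category `𝒞`: every `w ∈ W` is annihilated by all `E_{m,n}` with
`n` outside some finite set. -/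
def InC : Prop :=
  ∀ w : W, ∃ S : Finset ℤ, ∀ m n : ℤ, n ∉ S → ⁅E m n, w⁆ = 0

/-- `W` is integrable: every `E_{n,n}` is semisimple (`W` is the sum of its eigenspaces) and every
`E_{p,q}` with `p ≠ q` is locally nilpotent. -/
structure IsIntegrable : Prop where
  semisimple : ∀ n : ℤ,
    ⨆ μ : ℂ, Module.End.eigenspace (LieModule.toEnd ℂ glInf W (E n n)) μ = ⊤
  locallyNilpotent : ∀ p q : ℤ, p ≠ q → ∀ w : W, ∃ k : ℕ,
    (LieModule.toEnd ℂ glInf W (E p q) ^ k) w = 0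

/-- `W` belongs to the category `𝒞_int` of integrable modules in `𝒞`. -/
structure InCint : Prop where
  inC : InC W
  integrable : IsIntegrable W

end Categories

/-! ### Lie modules from modules over the enveloping algebra, and irreducible quotients -/

section General

variable (g : Type*) [LieRing g] [LieAlgebra ℂ g] (M : Type*) [AddCommGroup M]

/-- A left `U(g)`-module is a `g`-module through `ι : g → U(g)`. -/
@[reducible]
def lieRingModuleOfUEA [Module (UniversalEnvelopingAlgebra ℂ g) M] : LieRingModule g M where
  bracket x m := UniversalEnvelopingAlgebra.ι ℂ x • m
  add_lie x y m := by
    rw [map_add, add_smul]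
  lie_add x m n := smul_add _ m n
  leibniz_lie x y m := by
    change _ • _ • m = UniversalEnvelopingAlgebra.ι ℂ ⁅x, y⁆ • m + _ • _ • m
    let _ : LieRing (UniversalEnvelopingAlgebra ℂ g) := LieRing.ofAssociativeRing
    rw [LieHom.map_lie, LieRing.of_associative_ring_bracket, sub_smul, mul_smul, mul_smul]
    abel

lemma lieModuleOfUEA [Module ℂ M] [Module (UniversalEnvelopingAlgebra ℂ g) M]
    [IsScalarTower ℂ (UniversalEnvelopingAlgebra ℂ g) M] :
    let _ := lieRingModuleOfUEA g M
    LieModule ℂ g M := by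
  let _ := lieRingModuleOfUEA g M
  refine ⟨fun t x m => ?_, fun t x m => ?_⟩
  · change UniversalEnvelopingAlgebra.ι ℂ (t • x) • m = t • UniversalEnvelopingAlgebra.ι ℂ x • m
    rw [map_smul, smul_assoc]
  · change UniversalEnvelopingAlgebra.ι ℂ x • t • m = t • UniversalEnvelopingAlgebra.ι ℂ x • m
    rw [← algebraMap_smul (UniversalEnvelopingAlgebra ℂ g) t m, ← mul_smul,
      ← Algebra.commutes, mul_smul, algebraMap_smul]

/-- The quotient of a `g`-module by the sum of its proper submodules. If there is a unique maximal
proper submodule containing all proper ones, as for highest weight modules, this is the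
irreducible quotient. -/
abbrev IrrQuotient [Module ℂ M] [LieRingModule g M] [LieModule ℂ g M] : Type _ :=
  M ⧸ sSup {N : LieSubmodule ℂ g M | N ≠ ⊤}

end General

/-! ### Verma modules for `gl_S` and generalized Verma modules for `gl_∞` -/

section Verma

variable (S : Finset ℤ) (lam : Module.Dual ℂ H)

/-- The left ideal of `U(gl_S)` generated by `E_{m,n}` (`m < n` in `S`) and by
`E_{n,n} - λ(E_{n,n})` (`n ∈ S`). -/
def vermaIdeal : Submodule (UniversalEnvelopingAlgebra ℂ (glS S))
    (UniversalEnvelopingAlgebra ℂ (glS S)) :=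
  Submodule.span _
    ({a | ∃ (m n : ℤ) (hm : m ∈ S) (hn : n ∈ S), m < n ∧
        a = UniversalEnvelopingAlgebra.ι ℂ (ES hm hn)} ∪
     {a | ∃ (n : ℤ) (hn : n ∈ S),
        a = UniversalEnvelopingAlgebra.ι ℂ (ES hn hn) - algebraMap ℂ _ (lam (EH n))})

/-- The Verma `gl_S`-module `M(λ_S)` of highest weight `λ|_{H_S}`. -/
def Verma : Type := UniversalEnvelopingAlgebra ℂ (glS S) ⧸ vermaIdeal S lam

instance : AddCommGroup (Verma S lam) :=
  inferInstanceAs (AddCommGroup (UniversalEnvelopingAlgebra ℂ (glS S) ⧸ vermaIdeal S lam))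

instance : Module (UniversalEnvelopingAlgebra ℂ (glS S)) (Verma S lam) :=
  inferInstanceAs (Module _ (UniversalEnvelopingAlgebra ℂ (glS S) ⧸ vermaIdeal S lam))

instance : Module ℂ (Verma S lam) :=
  inferInstanceAs (Module ℂ (UniversalEnvelopingAlgebra ℂ (glS S) ⧸ vermaIdeal S lam))

instance : IsScalarTower ℂ (UniversalEnvelopingAlgebra ℂ (glS S)) (Verma S lam) :=
  inferInstanceAs (IsScalarTower ℂ _ (UniversalEnvelopingAlgebra ℂ (glS S) ⧸ vermaIdeal S lam))

instance : LieRingModule (glS S) (Verma S lam) := lieRingModuleOfUEA _ _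

instance : LieModule ℂ (glS S) (Verma S lam) := lieModuleOfUEA _ _

/-- `L(λ_S)`, the irreducible highest weight `gl_S`-module of highest weight `λ|_{H_S}`. -/
abbrev LS : Type := IrrQuotient (glS S) (Verma S lam)

variable (U : Type*) [AddCommGroup U] [Module ℂ U] [LieRingModule (glS S) U]
  [LieModule ℂ (glS S) U]

/-- The `U(gl_∞)`-submodule of `U(gl_∞) ⊗_ℂ U` generated by `x ⊗ u - 1 ⊗ x u` for `x` in
`gl_∞^{(S,+)} + gl_S`, where `gl_∞^{(S,+)}` acts on `U` by zero. The quotient is the tensor product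
over `U(gl_∞^{(S,+)} + gl_S)`. -/
def genVermaRel : Submodule (UniversalEnvelopingAlgebra ℂ glInf)
    (UniversalEnvelopingAlgebra ℂ glInf ⊗[ℂ] U) :=
  Submodule.span _
    ({a | ∃ (x : glS S) (u : U),
        a = UniversalEnvelopingAlgebra.ι ℂ (x : glInf) ⊗ₜ[ℂ] u - 1 ⊗ₜ[ℂ] ⁅x, u⁆} ∪
     {a | ∃ x ∈ glPlus S, ∃ u : U, a = UniversalEnvelopingAlgebra.ι ℂ x ⊗ₜ[ℂ] u})

/-- The generalized Verma module
`M(S, U) = U(gl_∞) ⊗_{U(gl_∞^{(S,+)} + gl_S)} U`. -/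
def GenVerma : Type _ := (UniversalEnvelopingAlgebra ℂ glInf ⊗[ℂ] U) ⧸ genVermaRel S U

instance : AddCommGroup (GenVerma S U) :=
  inferInstanceAs (AddCommGroup ((UniversalEnvelopingAlgebra ℂ glInf ⊗[ℂ] U) ⧸ genVermaRel S U))

instance : Module (UniversalEnvelopingAlgebra ℂ glInf) (GenVerma S U) :=
  inferInstanceAs (Module _ ((UniversalEnvelopingAlgebra ℂ glInf ⊗[ℂ] U) ⧸ genVermaRel S U))

instance : Module ℂ (GenVerma S U) :=
  inferInstanceAs (Module ℂ ((UniversalEnvelopingAlgebra ℂ glInf ⊗[ℂ] U) ⧸ genVermaRel S U))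

instance : IsScalarTower ℂ (UniversalEnvelopingAlgebra ℂ glInf) (GenVerma S U) :=
  inferInstanceAs (IsScalarTower ℂ _
    ((UniversalEnvelopingAlgebra ℂ glInf ⊗[ℂ] U) ⧸ genVermaRel S U))

instance : LieRingModule glInf (GenVerma S U) := lieRingModuleOfUEA _ _

instance : LieModule ℂ glInf (GenVerma S U) := lieModuleOfUEA _ _

/-- `L(S, λ)`, the irreducible quotient of `M(S, L(λ_S))`. -/
abbrev L : Type := IrrQuotient glInf (GenVerma S (LS S lam))

/-- `P_+(S)`: the `λ ∈ H^*` with `λ(E_{i,i}) ∈ ℕ` for all `i`, vanishing for `i ∉ S`, and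
weakly decreasing on `S`. -/
def PPlus : Set (Module.Dual ℂ H) :=
  {lam | ∃ a : ℤ → ℕ, (∀ i, lam (EH i) = (a i : ℂ)) ∧ (∀ i, i ∉ S → a i = 0) ∧
    ∀ i ∈ S, ∀ j ∈ S, i < j → a j ≤ a i}

end Verma

end GlInf

end

open scoped TensorProduct

noncomputable section

namespace GlInf

/-! ### Eigenspaces and invariant subspaces -/

section Eigen

variable {V : Type*} [AddCommGroup V] [Module ℂ V]

/-! Both halves rest on highest weight vectors: nonzero vectors of weight λ killed by `E m n` for n
∉ S and for m < n in S. An irreducible module containing one is L(S, λ)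
(`IsHighestWeight.nonempty_equiv_L`). So (2) asks for such a vector of dominant weight in W, and (1)
asks for one irreducible module in the category that has such a vector for each given λ.

Recognition. Such a vector defines a map from the Verma module. The vectors killed by gl_∞^{(S,+)}
on which the size operator (the identity matrix of gl_S) has a fixed eigenvalue form a simple
gl_S-module or zero when W is irreducible, so the map factors through L(λ_S) (`exists_ls_hom`) and
extends to M(S, L(λ_S)). Cyclic highest weight modules are graded by a diagonal element whose lowest
eigenspace is the line of the generator. Every proper submodule then avoids that line, so the sum of
the proper submodules is the unique maximal one (`IsGradedCyclic`). A reordering argument replaces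
the PBW theorem.

Part (2). A nonzero vector of W is killed by gl_∞^{(S,+)} for a large interval S. The vectors so
killed contain joint eigenvectors of the `E i i`; sl_2-theory for an index of S and one outside it
makes their weights natural numbers. A weight minimizing a linear size function is killed by the
raising operators, and sl_2-theory inside S makes it weakly decreasing.

Part (1). Without PBW even M(S, L(λ_S)) ≠ 0 needs a proof. The polynomials in a doubly infinite
matrix of variables form a module in 𝒞_int (`inCint_matPoly`), in which a product of powers of
leading minors is a highest weight vector of any given weight in P_+(S)
(`minorProduct_isHighestWeight`). The irreducible quotient of the submodule it generates stays in
𝒞_int, and by recognition it is L(S, λ). -/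

lemma mem_of_sum_eigenvectors_mem (f : Module.End ℂ V) (p : Submodule ℂ V)
    (hp : ∀ x ∈ p, f x ∈ p) (s : Finset ℂ) (x : ℂ → V)
    (hx : ∀ μ ∈ s, f (x μ) = μ • x μ) (hs : ∑ μ ∈ s, x μ ∈ p) : ∀ μ ∈ s, x μ ∈ p := by
  classical
  induction s using Finset.induction_on generalizing x with
  | empty => simp
  | insert ν s hν ih =>
    have key : ∀ μ ∈ s, x μ ∈ p := by
      -- Applying f - ν removes the ν-component and rescales the others by nonzero factors.
      have h₁ : ∑ μ ∈ s, (μ - ν) • x μ ∈ p := by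
        have h₂ := p.sub_mem (hp _ hs) (p.smul_mem ν hs)
        convert h₂ using 1
        rw [map_sum, Finset.smul_sum, ← Finset.sum_sub_distrib, Finset.sum_insert hν,
          hx ν (Finset.mem_insert_self _ _), sub_self, zero_add]
        exact Finset.sum_congr rfl fun μ hμ => by
          rw [hx μ (Finset.mem_insert_of_mem hμ), sub_smul]
      intro μ hμ
      have h₃ := ih (fun μ => (μ - ν) • x μ) (fun μ hμ => by
        rw [map_smul, hx μ (Finset.mem_insert_of_mem hμ), smul_comm]) h₁ μ hμ
      have hne : μ - ν ≠ 0 := sub_ne_zero.mpr fun h => hν (h ▸ hμ)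
      exact (p.smul_mem_iff hne).mp h₃
    intro μ hμ
    rcases Finset.mem_insert.mp hμ with rfl | hμ
    · rw [Finset.sum_insert hν] at hs
      exact (p.add_mem_iff_left (p.sum_mem key)).mp hs
    · exact key μ hμ

lemma mem_iSup_inf_eigenspace (f : Module.End ℂ V) (hf : ⨆ μ : ℂ, f.eigenspace μ = ⊤)
    (p : Submodule ℂ V) (hp : ∀ x ∈ p, f x ∈ p) {x : V} (hx : x ∈ p) :
    x ∈ ⨆ μ : ℂ, p ⊓ f.eigenspace μ := by
  have hx' : x ∈ ⨆ μ : ℂ, f.eigenspace μ := hf ▸ Submodule.mem_top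
  obtain ⟨y, hy, rfl⟩ := (Submodule.mem_iSup_iff_exists_finsupp _ _).mp hx'
  have h := mem_of_sum_eigenvectors_mem f p hp y.support y
    (fun μ _ => Module.End.mem_eigenspace_iff.mp (hy μ)) hx
  exact Submodule.sum_mem _ fun μ hμ => Submodule.mem_iSup_of_mem μ ⟨h μ hμ, hy μ⟩

/-- An invariant nonzero subspace of a diagonalizable operator contains an eigenvector. -/
lemma exists_eigenvector_mem (f : Module.End ℂ V) (hf : ⨆ μ : ℂ, f.eigenspace μ = ⊤)
    (p : Submodule ℂ V) (hp : ∀ x ∈ p, f x ∈ p) {x : V} (hx : x ∈ p) (h0 : x ≠ 0) :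
    ∃ μ : ℂ, ∃ y ∈ p, y ≠ 0 ∧ f y = μ • y := by
  by_contra! hcon
  have h := mem_iSup_inf_eigenspace f hf p hp hx
  have hbot : ⨆ μ : ℂ, p ⊓ f.eigenspace μ = ⊥ := by
    refine iSup_eq_bot.mpr fun μ => (Submodule.eq_bot_iff _).mpr fun y hy => ?_
    by_contra hy0
    exact hcon μ y hy.1 hy0 (Module.End.mem_eigenspace_iff.mp hy.2)
  rw [hbot] at h
  exact h0 ((Submodule.mem_bot ℂ).mp h)

end Eigen

/-! ### Modules graded by the eigenvalues of an element of the Lie algebra -/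

section Graded

variable {g : Type*} [LieRing g] [LieAlgebra ℂ g]
variable {M : Type*} [AddCommGroup M] [Module ℂ M] [LieRingModule g M] [LieModule ℂ g M]
variable {M' : Type*} [AddCommGroup M'] [Module ℂ M'] [LieRingModule g M'] [LieModule ℂ g M']

variable (M) in
/-- The sum of the eigenspaces of `D` for the eigenvalues `a + 1, a + 2, …`. -/
def above (D : g) (a : ℂ) : Submodule ℂ M :=
  ⨆ k : ℕ, (LieModule.toEnd ℂ g M D).eigenspace (a + (k + 1 : ℕ))

lemma mem_above (D : g) (a : ℂ) (k : ℕ) {x : M} (hx : ⁅D, x⁆ = (a + (k + 1 : ℕ)) • x) :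
    x ∈ above M D a :=
  Submodule.mem_iSup_of_mem k (Module.End.mem_eigenspace_iff.mpr hx)

lemma eq_zero_of_mem_above (D : g) (a : ℂ) {x : M} (hx : ⁅D, x⁆ = a • x)
    (hx' : x ∈ above M D a) : x = 0 := by
  have h := (Module.End.eigenspaces_iSupIndep (LieModule.toEnd ℂ g M D)) a
  refine Submodule.disjoint_def.mp h x (Module.End.mem_eigenspace_iff.mpr hx) ?_
  refine (iSup_le fun k => ?_ : above M D a ≤ _) hx'
  refine le_iSup₂_of_le (a + (k + 1 : ℕ)) ?_ le_rfl
  intro h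
  have : ((k + 1 : ℕ) : ℂ) = 0 := by simpa using h
  exact absurd (Nat.cast_eq_zero.mp this) (by omega)

lemma map_mem_above (f : M →ₗ⁅ℂ,g⁆ M') (D : g) (a : ℂ) {x : M} (hx : x ∈ above M D a) :
    f x ∈ above M' D a := by
  have : above M D a ≤ (above M' D a).comap (f : M →ₗ[ℂ] M') := by
    refine iSup_le fun k y hy => ?_
    have hy' : ⁅D, y⁆ = (a + (k + 1 : ℕ)) • y := Module.End.mem_eigenspace_iff.mp hy
    refine mem_above D a k ?_
    change ⁅D, f y⁆ = _ • f y
    rw [← LieModuleHom.map_lie, hy', map_smul]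
  exact this hx

/-- Modulo N, the image of x is both an a-eigenvector and a sum of eigenvectors for other
eigenvalues, hence zero. No diagonalizability of D is needed. -/
lemma mem_of_add_above_mem (N : LieSubmodule ℂ g M) (D : g) (a : ℂ) {x y : M}
    (hx : ⁅D, x⁆ = a • x) (hy : y ∈ above M D a) (hxy : x + y ∈ N) : x ∈ N := by
  have h1 : LieSubmodule.Quotient.mk' N x = - LieSubmodule.Quotient.mk' N y := by
    rw [eq_neg_iff_add_eq_zero, ← map_add]
    exact (LieSubmodule.Quotient.mk_eq_zero N).mpr hxy
  refine (LieSubmodule.Quotient.mk_eq_zero N).mp ?_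
  refine eq_zero_of_mem_above D a ?_ ?_
  · rw [← LieModuleHom.map_lie, hx, map_smul]
  · rw [h1]
    exact neg_mem (map_mem_above _ D a hy)

/-- Iterated brackets of members of the family `b` of positive degree with elements of `P`. -/
inductive LowerMonomial {ι : Type*} (b : ι → g) (deg : ι → ℤ) (P : Submodule ℂ M) : M → Prop
  | base (p : M) (hp : p ∈ P) : LowerMonomial b deg P p
  | step (i : ι) (hd : 0 < deg i) (m : M) (hm : LowerMonomial b deg P m) :
    LowerMonomial b deg P ⁅b i, m⁆

/-- If `P` is stable under the part of nonpositive degree, the submodule it generates is the sum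
of `P` and of a part of larger degree. -/
lemma lieSpan_le_sup_above {ι : Type*} (b : ι → g) (hb : Submodule.span ℂ (Set.range b) = ⊤)
    (deg : ι → ℤ) (D : g)
    (hD : ∀ i, ⁅D, b i⁆ = (deg i : ℂ) • b i) (a : ℂ) (P : Submodule ℂ M)
    (hDP : ∀ p ∈ P, ⁅D, p⁆ = a • p) (hP : ∀ i, deg i ≤ 0 → ∀ p ∈ P, ⁅b i, p⁆ ∈ P) :
    (LieSubmodule.lieSpan ℂ g (P : Set M)).toSubmodule ≤ P ⊔ above M D a := by
  set Q : Submodule ℂ M := Submodule.span ℂ {m | LowerMonomial b deg P m} with hQ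
  have hext (m : M) (h : ∀ i, ⁅b i, m⁆ ∈ Q) (z : g) : ⁅z, m⁆ ∈ Q := by
    have hz : z ∈ Submodule.span ℂ (Set.range b) := hb ▸ Submodule.mem_top
    induction hz using Submodule.span_induction with
    | mem x hx => obtain ⟨i, rfl⟩ := hx; exact h i
    | zero => simp
    | add x y _ _ h₁ h₂ => rw [add_lie]; exact add_mem h₁ h₂
    | smul c x _ h₁ => rw [smul_lie]; exact Submodule.smul_mem _ _ h₁
  have hlow (i : ι) (hd : 0 < deg i) (m : M) (hm : m ∈ Q) : ⁅b i, m⁆ ∈ Q := by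
    induction hm using Submodule.span_induction with
    | mem m hm => exact Submodule.subset_span (LowerMonomial.step i hd m hm)
    | zero => simp
    | add x y _ _ h₁ h₂ => rw [lie_add]; exact add_mem h₁ h₂
    | smul c x _ h₁ => rw [lie_smul]; exact Submodule.smul_mem _ _ h₁
  -- The substitute for PBW: a factor `b j` is moved past `b i` by the Jacobi identity. The
  -- commutator again acts on the shorter monomial m, where the induction hypothesis covers all of
  -- g.
  have hmono (m : M) (hm : LowerMonomial b deg P m) : ∀ j, ⁅b j, m⁆ ∈ Q := by
    induction hm with
    | base p hp =>
      intro j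
      by_cases hd : deg j ≤ 0
      · exact Submodule.subset_span (LowerMonomial.base _ (hP j hd p hp))
      · exact Submodule.subset_span (LowerMonomial.step j (by omega) _ (.base _ hp))
    | step i hd m hm ih =>
      intro j
      rw [leibniz_lie]
      exact add_mem (hext m ih _) (hlow i hd _ (ih j))
  have hstable (z : g) (m : M) (hm : m ∈ Q) : ⁅z, m⁆ ∈ Q := by
    induction hm using Submodule.span_induction with
    | mem m hm => exact hext m (hmono m hm) z
    | zero => simp
    | add x y _ _ h₁ h₂ => rw [lie_add]; exact add_mem h₁ h₂
    | smul c x _ h₁ => rw [lie_smul]; exact Submodule.smul_mem _ _ h₁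
  let N : LieSubmodule ℂ g M := { Q with lie_mem := fun {z m} hm => hstable z m hm }
  have h1 : LieSubmodule.lieSpan ℂ g (P : Set M) ≤ N :=
    LieSubmodule.lieSpan_le.mpr fun p hp => Submodule.subset_span (LowerMonomial.base p hp)
  have h2 (m : M) (hm : LowerMonomial b deg P m) :
      m ∈ P ∨ ∃ k : ℕ, ⁅D, m⁆ = (a + (k + 1 : ℕ)) • m := by
    have h3 : (m ∈ P ∧ ⁅D, m⁆ = a • m) ∨ ∃ k : ℕ, ⁅D, m⁆ = (a + (k + 1 : ℕ)) • m := by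
      induction hm with
      | base p hp => exact .inl ⟨hp, hDP p hp⟩
      | step i hd m hm ih =>
        -- A positive degree is written as j + 1, matching the offset k + 1 in `above`.
        obtain ⟨j, hj⟩ := Int.eq_ofNat_of_zero_le (by omega : 0 ≤ deg i - 1)
        have hj' : (deg i : ℂ) = j + 1 := by
          rw [show deg i = j + 1 by omega]; push_cast; rfl
        right
        rcases ih with ⟨-, ih⟩ | ⟨k, ih⟩
        · refine ⟨j, ?_⟩
          rw [leibniz_lie, hD i, ih, smul_lie, lie_smul, ← add_smul, hj']
          push_cast
          congr 1; ring
        · refine ⟨k + j + 1, ?_⟩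
          rw [leibniz_lie, hD i, ih, smul_lie, lie_smul, ← add_smul, hj']
          push_cast
          congr 1; ring
    exact h3.imp_left And.left
  refine le_trans h1 ?_
  refine Submodule.span_le.mpr fun m hm => ?_
  rcases h2 m hm with h | ⟨k, h⟩
  · exact Submodule.mem_sup_left h
  · exact Submodule.mem_sup_right (mem_above D a k h)

/-- A cyclic module generated by a highest weight vector, in terms of a grading element `D`. -/
structure IsGradedCyclic {ι : Type*} (b : ι → g) (deg : ι → ℤ) (D : g) (a : ℂ) (m₀ : M) : Prop where
  span_eq_top : Submodule.span ℂ (Set.range b) = ⊤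
  lie_deg : ∀ i, ⁅D, b i⁆ = (deg i : ℂ) • b i
  lie_gen : ⁅D, m₀⁆ = a • m₀
  lie_nonpos : ∀ i, deg i ≤ 0 → ∃ c : ℂ, ⁅b i, m₀⁆ = c • m₀
  cyclic : LieSubmodule.lieSpan ℂ g {m₀} = ⊤

namespace IsGradedCyclic

variable {ι : Type*} {b : ι → g} {deg : ι → ℤ} {D : g} {a : ℂ} {m₀ : M}

/-- The module is the line of m₀ plus the part above it. If an element of N had a nonzero component
along m₀, that component would lie in N, and N would be everything. -/
lemma le_above (h : IsGradedCyclic b deg D a m₀) {N : LieSubmodule ℂ g M} (hN : N ≠ ⊤) :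
    N.toSubmodule ≤ above M D a := by
  intro x hx
  have h1 := lieSpan_le_sup_above b h.span_eq_top deg D h.lie_deg a (Submodule.span ℂ {m₀})
    (fun p hp => by
      obtain ⟨c, rfl⟩ := Submodule.mem_span_singleton.mp hp
      rw [lie_smul, h.lie_gen, smul_comm])
    (fun i hd p hp => by
      obtain ⟨c, rfl⟩ := Submodule.mem_span_singleton.mp hp
      obtain ⟨e, he⟩ := h.lie_nonpos i hd
      rw [lie_smul, he]
      exact Submodule.smul_mem _ _ (Submodule.smul_mem _ _ (Submodule.mem_span_singleton_self _)))
  have h2 : LieSubmodule.lieSpan ℂ g (Submodule.span ℂ {m₀} : Set M) = ⊤ := by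
    rw [eq_top_iff, ← h.cyclic]
    exact LieSubmodule.lieSpan_mono Submodule.subset_span
  rw [h2] at h1
  obtain ⟨y, hy, z, hz, rfl⟩ := Submodule.mem_sup.mp (h1 (Submodule.mem_top (x := x)))
  obtain ⟨c, rfl⟩ := Submodule.mem_span_singleton.mp hy
  have h3 : c • m₀ ∈ N := mem_of_add_above_mem N D a
    (by rw [lie_smul, h.lie_gen, smul_comm]) hz hx
  by_cases hc : c = 0
  · simpa [hc] using hz
  · refine absurd ?_ hN
    rw [eq_top_iff, ← h.cyclic, LieSubmodule.lieSpan_le, Set.singleton_subset_iff]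
    exact (N.toSubmodule.smul_mem_iff hc).mp h3

lemma sSup_le_above (h : IsGradedCyclic b deg D a m₀) :
    (sSup {N : LieSubmodule ℂ g M | N ≠ ⊤}).toSubmodule ≤ above M D a := by
  rw [LieSubmodule.sSup_toSubmodule]
  refine sSup_le ?_
  rintro _ ⟨N, hN, rfl⟩
  exact h.le_above hN

lemma not_mem_sSup (h : IsGradedCyclic b deg D a m₀) (h0 : m₀ ≠ 0) :
    m₀ ∉ sSup {N : LieSubmodule ℂ g M | N ≠ ⊤} := fun hm =>
  h0 (eq_zero_of_mem_above D a h.lie_gen (h.sSup_le_above hm))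

lemma isIrreducible (h : IsGradedCyclic b deg D a m₀) (h0 : m₀ ≠ 0) :
    LieModule.IsIrreducible ℂ g (IrrQuotient g M) := by
  set K := sSup {N : LieSubmodule ℂ g M | N ≠ ⊤} with hK
  have hm : LieSubmodule.Quotient.mk' K m₀ ≠ 0 := fun hm =>
    h.not_mem_sSup h0 ((LieSubmodule.Quotient.mk_eq_zero _).mp hm)
  have : Nontrivial (IrrQuotient g M) := ⟨_, _, hm⟩
  refine LieModule.IsIrreducible.mk fun N hN => ?_
  by_contra hN'
  refine hN ((LieSubmodule.eq_bot_iff _).mpr fun x hx => ?_)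
  obtain ⟨x, rfl⟩ := LieSubmodule.Quotient.surjective_mk' K x
  have h1 : N.comap (LieSubmodule.Quotient.mk' K) ≠ ⊤ := by
    intro h2
    refine hN' (eq_top_iff.mpr fun y _ => ?_)
    obtain ⟨y, rfl⟩ := LieSubmodule.Quotient.surjective_mk' K y
    have : y ∈ N.comap (LieSubmodule.Quotient.mk' K) := h2 ▸ LieSubmodule.mem_top y
    exact this
  exact (LieSubmodule.Quotient.mk_eq_zero _).mpr ((le_sSup h1 : _ ≤ K) hx)

end IsGradedCyclic

/-- A surjection from a graded cyclic module onto an irreducible module identifies the latter with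
the irreducible quotient. -/
lemma IsGradedCyclic.nonempty_equiv {ι : Type*} {b : ι → g} {deg : ι → ℤ} {D : g} {a : ℂ} {m₀ : M}
    (h : IsGradedCyclic b deg D a m₀) [LieModule.IsIrreducible ℂ g M'] (f : M →ₗ⁅ℂ,g⁆ M')
    (h0 : f m₀ ≠ 0) : Nonempty (M' ≃ₗ⁅ℂ,g⁆ IrrQuotient g M) := by
  set K := sSup {N : LieSubmodule ℂ g M | N ≠ ⊤} with hK
  have hm0 : m₀ ≠ 0 := fun h => h0 (by rw [h, map_zero])
  have hirr := h.isIrreducible hm0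
  have hsurj : Function.Surjective f := by
    rw [← LieModuleHom.range_eq_top]
    refine (IsSimpleOrder.eq_bot_or_eq_top f.range).resolve_left fun hb => h0 ?_
    have : f m₀ ∈ f.range := (LieModuleHom.mem_range f _).mpr ⟨m₀, rfl⟩
    rwa [hb, LieSubmodule.mem_bot] at this
  have hker : f.ker = K := by
    refine le_antisymm (le_sSup fun hk => h0 ?_) ?_
    · exact LieModuleHom.mem_ker.mp (hk ▸ LieSubmodule.mem_top m₀)
    -- Otherwise f(K) is all of M', so f m₀, of eigenvalue a, would be a sum of eigenvectors of
    -- larger degree.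
    · have h1 : K.map f = ⊥ := by
        refine (IsSimpleOrder.eq_bot_or_eq_top (K.map f)).resolve_right fun ht => h0 ?_
        have : f m₀ ∈ K.map f := ht ▸ LieSubmodule.mem_top _
        obtain ⟨x, hx, hxe⟩ := (LieSubmodule.mem_map _).mp this
        refine eq_zero_of_mem_above D a ?_ (hxe ▸ map_mem_above f D a (h.sSup_le_above hx))
        rw [← LieModuleHom.map_lie, h.lie_gen, map_smul]
      intro x hx
      have : f x ∈ K.map f := LieSubmodule.mem_map_of_mem hx
      rw [h1, LieSubmodule.mem_bot] at this
      exact LieModuleHom.mem_ker.mpr this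
  have hker' : (f : M →ₗ[ℂ] M').ker = K.toSubmodule := by rw [← hker]; rfl
  let e : (M ⧸ K.toSubmodule) ≃ₗ[ℂ] M' :=
    (Submodule.quotEquivOfEq _ _ hker'.symm).trans
      ((f : M →ₗ[ℂ] M').quotKerEquivOfSurjective hsurj)
  let F : IrrQuotient g M →ₗ⁅ℂ,g⁆ M' :=
    { toFun := e
      map_add' := e.map_add
      map_smul' := e.map_smul
      map_lie' := by
        intro x m
        obtain ⟨m, rfl⟩ := LieSubmodule.Quotient.surjective_mk' K m
        exact f.map_lie x m }
  let E : IrrQuotient g M ≃ₗ⁅ℂ,g⁆ M' :=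
    { F with
      invFun := e.symm
      left_inv := e.left_inv
      right_inv := e.right_inv }
  exact ⟨E.symm⟩

end Graded

/-! ### Primitive vectors and local nilpotency -/

/-- If k + 1 is the least power of f killing m, then 0 = e f^{k+1} m = (k + 1)(μ - k) f^k m with f^k
m ≠ 0, so μ = k. -/
lemma primitive_weight_nat {g : Type*} [LieRing g] [LieAlgebra ℂ g] {M : Type*} [AddCommGroup M]
    [Module ℂ M] [LieRingModule g M] [LieModule ℂ g M] {h e f : g} (t : IsSl2Triple h e f)
    {m : M} {μ : ℂ} (P : t.HasPrimitiveVectorWith m μ)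
    (hf : ∃ k : ℕ, (LieModule.toEnd ℂ g M f ^ k) m = 0) : ∃ k : ℕ, μ = k := by
  classical
  have h1 := Nat.find_spec hf
  have h2 := @Nat.find_min _ _ hf
  obtain ⟨k, hk⟩ : ∃ k, Nat.find hf = k + 1 := by
    refine Nat.exists_eq_succ_of_ne_zero fun h0 => P.ne_zero ?_
    rw [h0] at h1
    simpa using h1
  refine ⟨k, ?_⟩
  have h3 := P.lie_e_pow_succ_toEnd_f k
  rw [hk] at h1 h2
  rw [h1, lie_zero] at h3
  have h4 := (smul_eq_zero.mp h3.symm).resolve_right (h2 (Nat.lt_succ_self k))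
  have h5 : ((k : ℂ) + 1) ≠ 0 := Nat.cast_add_one_ne_zero k
  exact sub_eq_zero.mp ((mul_eq_zero.mp h4).resolve_left h5)

/-! ### Submodules and quotients of modules in `𝒞_int` -/

section Closure

variable {W : Type*} [AddCommGroup W] [Module ℂ W] [LieRingModule glInf W] [LieModule ℂ glInf W]
variable {W' : Type*} [AddCommGroup W'] [Module ℂ W'] [LieRingModule glInf W']
  [LieModule ℂ glInf W']

lemma map_toEnd_pow (f : W →ₗ⁅ℂ,glInf⁆ W') (x : glInf) (k : ℕ) (w : W) :
    f ((LieModule.toEnd ℂ glInf W x ^ k) w) = (LieModule.toEnd ℂ glInf W' x ^ k) (f w) := by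
  induction k with
  | zero => simp
  | succ k ih =>
    rw [pow_succ', pow_succ', Module.End.mul_apply, Module.End.mul_apply, ← ih]
    exact f.map_lie x _

lemma InCint.of_surjective (h : InCint W) (f : W →ₗ⁅ℂ,glInf⁆ W') (hf : Function.Surjective f) :
    InCint W' where
  inC w' := by
    obtain ⟨w, rfl⟩ := hf w'
    obtain ⟨T, hT⟩ := h.inC w
    exact ⟨T, fun m n hn => by rw [← LieModuleHom.map_lie, hT m n hn, map_zero]⟩
  integrable :=
    { semisimple := fun n => by
        rw [eq_top_iff, ← LinearMap.range_eq_top.mpr (show Function.Surjective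
          (f : W →ₗ[ℂ] W') from hf), ← Submodule.map_top, ← h.integrable.semisimple n,
          Submodule.map_iSup]
        refine iSup_mono fun μ => ?_
        rintro _ ⟨w, hw, rfl⟩
        have hw' : ⁅E n n, w⁆ = μ • w := Module.End.mem_eigenspace_iff.mp hw
        refine Module.End.mem_eigenspace_iff.mpr ?_
        change ⁅E n n, f w⁆ = μ • f w
        rw [← LieModuleHom.map_lie, hw', map_smul]
      locallyNilpotent := fun p q hpq w' => by
        obtain ⟨w, rfl⟩ := hf w'
        obtain ⟨k, hk⟩ := h.integrable.locallyNilpotent p q hpq w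
        exact ⟨k, by rw [← map_toEnd_pow, hk, map_zero]⟩ }

lemma InCint.lieSubmodule (h : InCint W) (N : LieSubmodule ℂ glInf W) : InCint N where
  inC w := by
    obtain ⟨T, hT⟩ := h.inC (w : W)
    exact ⟨T, fun m n hn => Subtype.ext (hT m n hn)⟩
  integrable :=
    { semisimple := fun n => by
        rw [eq_top_iff]
        intro x _
        have h1 := mem_iSup_inf_eigenspace _ (h.integrable.semisimple n) N.toSubmodule
          (fun x hx => N.lie_mem hx) x.2
        have h2 : (⨆ μ : ℂ, N.toSubmodule ⊓
            (LieModule.toEnd ℂ glInf W (E n n)).eigenspace μ) ≤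
            (⨆ μ : ℂ, (LieModule.toEnd ℂ glInf N (E n n)).eigenspace μ).map
              N.toSubmodule.subtype := by
          rw [Submodule.map_iSup]
          refine iSup_mono fun μ y hy => ⟨⟨y, hy.1⟩, ?_, rfl⟩
          exact Module.End.mem_eigenspace_iff.mpr
            (Subtype.ext (Module.End.mem_eigenspace_iff.mp hy.2))
        obtain ⟨y, hy, hyx⟩ := h2 h1
        have : y = x := Subtype.ext hyx
        exact this ▸ hy
      locallyNilpotent := fun p q hpq w => by
        obtain ⟨k, hk⟩ := h.integrable.locallyNilpotent p q hpq w
        refine ⟨k, Subtype.ext ?_⟩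
        have := map_toEnd_pow N.incl (E p q) k w
        exact this.trans hk }

end Closure

/-! ### Modules over enveloping algebras -/

section Enveloping

attribute [local instance 100] LieRing.ofAssociativeRing

variable {g : Type*} [LieRing g] [LieAlgebra ℂ g]

lemma uea_smul_mem {X : Type*} [AddCommGroup X] [Module ℂ X]
    [Module (UniversalEnvelopingAlgebra ℂ g) X]
    [IsScalarTower ℂ (UniversalEnvelopingAlgebra ℂ g) X] (N : Submodule ℂ X)
    (hN : ∀ (x : g), ∀ m ∈ N, UniversalEnvelopingAlgebra.ι ℂ x • m ∈ N)
    (a : UniversalEnvelopingAlgebra ℂ g) : ∀ m ∈ N, a • m ∈ N := by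
  have hsurj : Function.Surjective (UniversalEnvelopingAlgebra.mkAlgHom ℂ g) :=
    Quotient.mk_surjective
  obtain ⟨t, rfl⟩ := hsurj a
  induction t using TensorAlgebra.induction with
  | algebraMap c =>
    intro m hm
    rw [AlgHom.commutes, algebraMap_smul]
    exact N.smul_mem c hm
  | ι x => exact hN x
  | mul a b ha hb =>
    intro m hm
    rw [map_mul, mul_smul]
    exact ha _ (hb _ hm)
  | add a b ha hb =>
    intro m hm
    rw [map_add, add_smul]
    exact add_mem (ha _ hm) (hb _ hm)

/-- The action of the enveloping algebra on a module over the Lie algebra. -/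
def ueaAction (g W : Type*) [LieRing g] [LieAlgebra ℂ g] [AddCommGroup W] [Module ℂ W]
    [LieRingModule g W] [LieModule ℂ g W] :
    UniversalEnvelopingAlgebra ℂ g →ₐ[ℂ] Module.End ℂ W :=
  UniversalEnvelopingAlgebra.lift ℂ (LieModule.toEnd ℂ g W)

lemma ueaAction_ι {W : Type*} [AddCommGroup W] [Module ℂ W] [LieRingModule g W]
    [LieModule ℂ g W] (x : g) (w : W) :
    ueaAction g W (UniversalEnvelopingAlgebra.ι ℂ x) w = ⁅x, w⁆ := by
  rw [ueaAction, UniversalEnvelopingAlgebra.lift_ι_apply]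
  rfl

/-- The kernel of an equivariant map is stable under g, hence under U(g), so it contains the
U(g)-span of s once it contains s. This gives the universal properties of both Verma and generalized
Verma modules. -/
lemma exists_map_quotient_span {X : Type*} [AddCommGroup X] [Module ℂ X]
    [Module (UniversalEnvelopingAlgebra ℂ g) X]
    [IsScalarTower ℂ (UniversalEnvelopingAlgebra ℂ g) X]
    {W : Type*} [AddCommGroup W] [Module ℂ W] [LieRingModule g W] [LieModule ℂ g W]
    (s : Set X) (ψ : X →ₗ[ℂ] W)
    (hψ : ∀ (x : g) (y : X), ψ (UniversalEnvelopingAlgebra.ι ℂ x • y) = ⁅x, ψ y⁆)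
    (hs : ∀ y ∈ s, ψ y = 0) :
    ∃ F : (X ⧸ Submodule.span (UniversalEnvelopingAlgebra ℂ g) s) →ₗ[ℂ] W,
      (∀ y, F (Submodule.Quotient.mk y) = ψ y) ∧
      ∀ (x : g) q, F (UniversalEnvelopingAlgebra.ι ℂ x • q) = ⁅x, F q⁆ := by
  have hle : (Submodule.span (UniversalEnvelopingAlgebra ℂ g) s).restrictScalars ℂ ≤
      LinearMap.ker ψ := by
    intro y (hy : y ∈ Submodule.span (UniversalEnvelopingAlgebra ℂ g) s)
    induction hy using Submodule.span_induction with
    | mem y hy => exact hs y hy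
    | zero => exact zero_mem _
    | add y z hy hz h₁ h₂ => exact add_mem h₁ h₂
    | smul a y hy h =>
      refine uea_smul_mem (LinearMap.ker ψ) (fun x m hm => ?_) a y h
      rw [LinearMap.mem_ker] at hm ⊢
      rw [hψ, hm, lie_zero]
  let F := (Submodule.liftQ _ ψ hle) ∘ₗ
    (Submodule.Quotient.restrictScalarsEquiv ℂ
      (Submodule.span (UniversalEnvelopingAlgebra ℂ g) s)).symm.toLinearMap
  have hF : ∀ y, F (Submodule.Quotient.mk y) = ψ y := fun y => rfl
  refine ⟨F, hF, fun x q => ?_⟩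
  obtain ⟨y, rfl⟩ := Submodule.Quotient.mk_surjective _ q
  rw [← Submodule.Quotient.mk_smul, hF, hF, hψ]

end Enveloping

/-! ### Diagonal elements and gradings -/

/-- The diagonal matrix with entries `c i` for `i ∈ S`. -/
def diag (S : Finset ℤ) (c : ℤ → ℤ) : glS S :=
  ∑ i : S, (c i : ℂ) • ES i.2 i.2

lemma coe_diag (S : Finset ℤ) (c : ℤ → ℤ) :
    (diag S c : glInf) = ∑ i ∈ S, (c i : ℂ) • E i i := by
  rw [diag, ← Finset.sum_coe_sort S (fun i => (c i : ℂ) • E i i)]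
  exact map_sum (glS S).incl _ _

lemma lie_diag_E (S : Finset ℤ) (c : ℤ → ℤ) (m n : ℤ) :
    ⁅(diag S c : glInf), E m n⁆ =
      (((if m ∈ S then c m else 0) - (if n ∈ S then c n else 0) : ℤ) : ℂ) • E m n := by
  have h (i : ℤ) : ⁅(c i : ℂ) • E i i, E m n⁆ =
      (if i = m then (c i : ℂ) • E m n else 0) - (if i = n then (c i : ℂ) • E m n else 0) := by
    rw [smul_lie, lie_E, smul_sub]
    congr 1 <;> split_ifs with h₁
    all_goals first | rw [h₁] | exact smul_zero _
  rw [coe_diag, sum_lie, Finset.sum_congr rfl fun i _ => h i, Finset.sum_sub_distrib,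
    Finset.sum_ite_eq', Finset.sum_ite_eq']
  split_ifs <;> simp [sub_smul]

attribute [local instance 100] LieRing.ofAssociativeRing in
lemma span_E : Submodule.span ℂ (Set.range fun p : ℤ × ℤ => E p.1 p.2) = ⊤ := by
  refine eq_top_iff.mpr fun x _ => ?_
  have hx : (x : Module.End ℂ CInf) ∈ Submodule.span ℂ {x | ∃ m n : ℤ, x = matUnit m n} := x.2
  have hle : Submodule.span ℂ {x | ∃ m n : ℤ, x = matUnit m n} ≤
      (Submodule.span ℂ (Set.range fun p : ℤ × ℤ => E p.1 p.2)).map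
        glInf.toSubmodule.subtype := by
    refine Submodule.span_le.mpr ?_
    rintro _ ⟨m, n, rfl⟩
    exact ⟨E m n, Submodule.subset_span ⟨(m, n), rfl⟩, rfl⟩
  obtain ⟨y, hy, hyx⟩ := hle hx
  have : y = x := Subtype.ext hyx
  exact this ▸ hy

lemma span_ES (S : Finset ℤ) :
    Submodule.span ℂ (Set.range fun p : S × S => ES p.1.2 p.2.2) = ⊤ := by
  refine eq_top_iff.mpr fun x _ => ?_
  have hx : (x : glInf) ∈ Submodule.span ℂ {x | ∃ m ∈ S, ∃ n ∈ S, x = E m n} := x.2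
  have hle : Submodule.span ℂ {x | ∃ m ∈ S, ∃ n ∈ S, x = E m n} ≤
      (Submodule.span ℂ (Set.range fun p : S × S => ES p.1.2 p.2.2)).map
        (glS S).toSubmodule.subtype := by
    refine Submodule.span_le.mpr ?_
    rintro _ ⟨m, hm, n, hn, rfl⟩
    exact ⟨ES hm hn, Submodule.subset_span ⟨(⟨m, hm⟩, ⟨n, hn⟩), rfl⟩, rfl⟩
  obtain ⟨y, hy, hyx⟩ := hle hx
  have : y = x := Subtype.ext hyx
  exact this ▸ hy

/-! ### Highest weight vectors -/

section HighestWeight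

variable {W : Type*} [AddCommGroup W] [Module ℂ W] [LieRingModule glInf W] [LieModule ℂ glInf W]

/-- Nonzero vectors of weight `λ` annihilated by `E_{m,n}` for `n ∉ S` and for `m < n` in `S`. -/
structure IsHighestWeight (S : Finset ℤ) (lam : Module.Dual ℂ H) (v : W) : Prop where
  ne_zero : v ≠ 0
  outside : ∀ m n, n ∉ S → ⁅E m n, v⁆ = 0
  upper : ∀ m ∈ S, ∀ n ∈ S, m < n → ⁅E m n, v⁆ = 0
  weight : ∀ i ∈ S, ⁅E i i, v⁆ = lam (EH i) • v

/-- The eigenvalue of `diag S c` on vectors of weight `λ`. -/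
def diagWeight (S : Finset ℤ) (lam : Module.Dual ℂ H) (c : ℤ → ℤ) : ℂ :=
  ∑ i ∈ S, (c i : ℂ) * lam (EH i)

lemma lie_diag_of_weight {S : Finset ℤ} {lam : Module.Dual ℂ H} {v : W}
    (hv : ∀ i ∈ S, ⁅E i i, v⁆ = lam (EH i) • v) (c : ℤ → ℤ) :
    ⁅(diag S c : glInf), v⁆ = diagWeight S lam c • v := by
  rw [coe_diag, sum_lie, diagWeight, Finset.sum_smul]
  exact Finset.sum_congr rfl fun i hi => by rw [smul_lie, hv i hi, smul_smul]

/-- A degree function on `ℤ` that increases on `S` and is maximal, equal to `0`, off `S`. -/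
def level (S : Finset ℤ) (N : ℤ) (i : ℤ) : ℤ := if i ∈ S then i - N else 0

/-- Since `level` is negative on S and zero elsewhere, `E m n` with m ∉ S and n ∈ S has positive
degree. The matrix units of degree at most 0 either kill v or are diagonal. -/
lemma IsHighestWeight.isGradedCyclic {S : Finset ℤ} {N : ℤ} (hN : ∀ i ∈ S, i < N)
    {lam : Module.Dual ℂ H} {v : W} (hv : IsHighestWeight S lam v)
    (hgen : LieSubmodule.lieSpan ℂ glInf {v} = ⊤) :
    IsGradedCyclic (fun p : ℤ × ℤ => E p.1 p.2) (fun p => level S N p.1 - level S N p.2)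
      (diag S (· - N) : glInf) (diagWeight S lam (· - N)) v where
  span_eq_top := span_E
  lie_deg p := lie_diag_E S _ _ _
  lie_gen := lie_diag_of_weight hv.weight _
  lie_nonpos := by
    rintro ⟨m, n⟩ hd
    change level S N m - level S N n ≤ 0 at hd
    change ∃ c : ℂ, ⁅E m n, v⁆ = c • v
    by_cases hn : n ∈ S
    · have hn' := hN n hn
      by_cases hm : m ∈ S
      · simp only [level, hm, hn, if_true] at hd
        rcases (by omega : m ≤ n).lt_or_eq with h | rfl
        · exact ⟨0, by rw [hv.upper m hm n hn h, zero_smul]⟩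
        · exact ⟨_, hv.weight m hm⟩
      · simp only [level, hm, hn, if_true, if_false] at hd
        omega
    · exact ⟨0, by rw [hv.outside m n hn, zero_smul]⟩
  cyclic := hgen

/-- Vectors killed by `gl_∞^{(S,+)}`. -/
def vacuum (S : Finset ℤ) (W : Type*) [AddCommGroup W] [Module ℂ W] [LieRingModule glInf W]
    [LieModule ℂ glInf W] : Submodule ℂ W where
  carrier := {w | ∀ m n, n ∉ S → ⁅E m n, w⁆ = 0}
  add_mem' ha hb m n hn := by rw [lie_add, ha m n hn, hb m n hn, add_zero]
  zero_mem' m n _ := lie_zero _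
  smul_mem' c w hw m n hn := by rw [lie_smul, hw m n hn, smul_zero]

/-- For n ∉ S the commutator of `E m n` with `E p q` can only contribute a multiple of `E p n`,
which also kills w. -/
lemma lie_E_mem_vacuum {S : Finset ℤ} {w : W} (hw : w ∈ vacuum S W) {p q : ℤ} (hp : p ∈ S) :
    ⁅E p q, w⁆ ∈ vacuum S W := by
  intro m n hn
  have hnp : n ≠ p := fun h => hn (h ▸ hp)
  rw [leibniz_lie, lie_E, if_neg hnp, hw m n hn, lie_zero, add_zero, zero_sub, neg_lie]
  split_ifs
  · rw [hw p n hn, neg_zero]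
  · simp

lemma lie_mem_of_lie_ES_mem {S : Finset ℤ} {Y : Submodule ℂ W}
    (hY : ∀ p ∈ S, ∀ q ∈ S, ∀ w ∈ Y, ⁅E p q, w⁆ ∈ Y) (x : glS S) {w : W} (hw : w ∈ Y) :
    ⁅(x : glInf), w⁆ ∈ Y := by
  obtain ⟨x, hx⟩ := x
  change ⁅x, w⁆ ∈ Y
  replace hx : x ∈ Submodule.span ℂ {x | ∃ m ∈ S, ∃ n ∈ S, x = E m n} := hx
  induction hx using Submodule.span_induction with
  | mem x hx =>
    obtain ⟨m, hm, n, hn, rfl⟩ := hx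
    exact hY m hm n hn w hw
  | zero => simp
  | add x y _ _ h₁ h₂ => rw [add_lie]; exact add_mem h₁ h₂
  | smul c x _ h₁ => rw [smul_lie]; exact Submodule.smul_mem _ _ h₁

lemma lie_glPlus_eq_zero {S : Finset ℤ} {w : W} (hw : w ∈ vacuum S W) {x : glInf}
    (hx : x ∈ glPlus S) : ⁅x, w⁆ = 0 := by
  induction hx using Submodule.span_induction with
  | mem x hx =>
    obtain ⟨m, n, hn, rfl⟩ := hx
    exact hw m n hn
  | zero => simp
  | add x y _ _ h₁ h₂ => rw [add_lie, h₁, h₂, add_zero]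
  | smul c x _ h₁ => rw [smul_lie, h₁, smul_zero]

/-- In an irreducible module the top level is irreducible under `gl_S`: a `gl_S`-stable subspace of
the vacuum space, on which the size operator is scalar, either vanishes or contains all such
vectors. -/
lemma mem_of_glS_stable [LieModule.IsIrreducible ℂ glInf W] {S : Finset ℤ} {a : ℂ}
    {P : Submodule ℂ W} (hvac : P ≤ vacuum S W) (hP : ∀ p ∈ S, ∀ q ∈ S, ∀ w ∈ P, ⁅E p q, w⁆ ∈ P)
    (ha : ∀ w ∈ P, ⁅(diag S (fun _ => -1) : glInf), w⁆ = a • w) {w : W} (hw : w ∈ P) (h0 : w ≠ 0)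
    {v : W} (hv : ⁅(diag S (fun _ => -1) : glInf), v⁆ = a • v) : v ∈ P := by
  -- With this grading the degree-zero units having n ∈ S are those of gl_S, the units with m ∉ S
  -- and n ∈ S have degree 1, and every remaining unit has n ∉ S and kills P.
  have h1 := lieSpan_le_sup_above (fun p : ℤ × ℤ => E p.1 p.2) span_E
    (fun p => (if p.1 ∈ S then -1 else 0) - (if p.2 ∈ S then -1 else 0))
    (diag S (fun _ => -1) : glInf) (fun p => lie_diag_E S _ _ _) a P ha (by
      rintro ⟨m, n⟩ hd w hw
      dsimp only at hd ⊢
      by_cases hn : n ∈ S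
      · by_cases hm : m ∈ S
        · exact hP m hm n hn w hw
        · simp [hm, hn] at hd
      · rw [hvac hw m n hn]
        exact zero_mem _)
  have h2 : LieSubmodule.lieSpan ℂ glInf (P : Set W) = ⊤ := by
    refine (IsSimpleOrder.eq_bot_or_eq_top _).resolve_left fun hb => h0 ?_
    have : w ∈ LieSubmodule.lieSpan ℂ glInf (P : Set W) := LieSubmodule.subset_lieSpan hw
    rwa [hb, LieSubmodule.mem_bot] at this
  rw [h2] at h1
  obtain ⟨y, hy, z, hz, rfl⟩ := Submodule.mem_sup.mp (h1 (Submodule.mem_top (x := v)))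
  have hz0 : z = 0 := by
    refine eq_zero_of_mem_above _ a ?_ hz
    have := ha y hy
    rw [lie_add, smul_add, this] at hv
    exact add_left_cancel hv
  rwa [hz0, add_zero]

end HighestWeight

/-! ### Verma modules -/

section VermaModule

variable (S : Finset ℤ) (lam : Module.Dual ℂ H)

/-- The highest weight vector of the Verma module. -/
def vermaGen : Verma S lam := Submodule.Quotient.mk (p := vermaIdeal S lam) 1

lemma verma_cyclic : LieSubmodule.lieSpan ℂ (glS S) {vermaGen S lam} = ⊤ := by
  refine eq_top_iff.mpr fun x _ => ?_
  obtain ⟨a, rfl⟩ := Submodule.Quotient.mk_surjective (vermaIdeal S lam) x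
  have h := uea_smul_mem (LieSubmodule.lieSpan ℂ (glS S) {vermaGen S lam}).toSubmodule
    (fun x m hm => (LieSubmodule.lieSpan ℂ (glS S) {vermaGen S lam}).lie_mem hm) a
    (vermaGen S lam) (LieSubmodule.subset_lieSpan rfl)
  have h2 : a • vermaGen S lam = Submodule.Quotient.mk (p := vermaIdeal S lam) a := by
    change Submodule.Quotient.mk (p := vermaIdeal S lam) (a • 1) = _
    rw [smul_eq_mul, mul_one]
  rw [← h2]
  exact h

lemma lie_vermaGen (x : glS S) : ⁅x, vermaGen S lam⁆ =
    Submodule.Quotient.mk (p := vermaIdeal S lam) (UniversalEnvelopingAlgebra.ι ℂ x) := by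
  change Submodule.Quotient.mk (p := vermaIdeal S lam) (UniversalEnvelopingAlgebra.ι ℂ x • 1) = _
  rw [smul_eq_mul, mul_one]

variable {S} in
lemma lie_ES_vermaGen_of_lt {m n : ℤ} (hm : m ∈ S) (hn : n ∈ S) (h : m < n) :
    ⁅ES hm hn, vermaGen S lam⁆ = 0 := by
  rw [lie_vermaGen]
  exact (Submodule.Quotient.mk_eq_zero _).mpr (Submodule.subset_span (.inl ⟨m, n, hm, hn, h, rfl⟩))

variable {S} in
lemma lie_ES_vermaGen_self {n : ℤ} (hn : n ∈ S) :
    ⁅ES hn hn, vermaGen S lam⁆ = lam (EH n) • vermaGen S lam := by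
  rw [lie_vermaGen]
  have h : lam (EH n) • vermaGen S lam = Submodule.Quotient.mk (p := vermaIdeal S lam)
      (algebraMap ℂ (UniversalEnvelopingAlgebra ℂ (glS S)) (lam (EH n))) := by
    rw [Algebra.algebraMap_eq_smul_one]
    rfl
  rw [h]
  exact (Submodule.Quotient.eq _).mpr (Submodule.subset_span (.inr ⟨n, hn, rfl⟩))

lemma verma_isGradedCyclic (N : ℤ) :
    IsGradedCyclic (fun p : S × S => ES p.1.2 p.2.2) (fun p => (p.1 : ℤ) - p.2)
      (diag S (· - N)) (diagWeight S lam (· - N)) (vermaGen S lam) where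
  span_eq_top := span_ES S
  lie_deg p := by
    apply Subtype.ext
    have h := lie_diag_E S (· - N) p.1 p.2
    simp only [p.1.2, p.2.2, if_true, sub_sub_sub_cancel_right] at h
    exact h
  lie_gen := by
    rw [diag, sum_lie, diagWeight, Finset.sum_smul,
      ← Finset.sum_coe_sort S (fun i => (((i - N : ℤ) : ℂ) * lam (EH i)) • vermaGen S lam)]
    exact Finset.sum_congr rfl fun i _ => by rw [smul_lie, lie_ES_vermaGen_self, smul_smul]
  lie_nonpos := by
    rintro ⟨⟨m, hm⟩, ⟨n, hn⟩⟩ hd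
    change m - n ≤ 0 at hd
    rcases (by omega : m ≤ n).lt_or_eq with h | rfl
    · exact ⟨0, by rw [lie_ES_vermaGen_of_lt lam hm hn h, zero_smul]⟩
    · exact ⟨_, lie_ES_vermaGen_self lam hm⟩
  cyclic := verma_cyclic S lam

variable {S lam}
variable {W : Type*} [AddCommGroup W] [Module ℂ W] [LieRingModule glInf W] [LieModule ℂ glInf W]

lemma exists_verma_hom {v : W} (hv : IsHighestWeight S lam v) :
    ∃ F : Verma S lam →ₗ⁅ℂ,glS S⁆ W, F (vermaGen S lam) = v := by
  let ψ : UniversalEnvelopingAlgebra ℂ (glS S) →ₗ[ℂ] W :=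
    LinearMap.applyₗ v ∘ₗ (ueaAction (glS S) W).toLinearMap
  have hψ (a) : ψ a = ueaAction (glS S) W a v := rfl
  obtain ⟨F, h1, h2⟩ := exists_map_quotient_span (g := glS S)
    ({a | ∃ (m n : ℤ) (hm : m ∈ S) (hn : n ∈ S), m < n ∧
        a = UniversalEnvelopingAlgebra.ι ℂ (ES hm hn)} ∪
     {a | ∃ (n : ℤ) (hn : n ∈ S),
        a = UniversalEnvelopingAlgebra.ι ℂ (ES hn hn) - algebraMap ℂ _ (lam (EH n))}) ψ
    (fun x y => by rw [hψ, hψ, smul_eq_mul, map_mul, Module.End.mul_apply, ueaAction_ι]) (by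
      rintro _ (⟨m, n, hm, hn, h, rfl⟩ | ⟨n, hn, rfl⟩)
      · rw [hψ, ueaAction_ι]
        exact hv.upper m hm n hn h
      · rw [map_sub, hψ, hψ, ueaAction_ι, AlgHom.commutes, sub_eq_zero]
        exact hv.weight n hn)
  refine ⟨{ toFun := F, map_add' := F.map_add, map_smul' := F.map_smul, map_lie' := h2 _ _ }, ?_⟩
  refine (h1 1).trans ?_
  rw [hψ, map_one]
  rfl

/-- The highest weight vector of `L(λ_S)`. -/
def lsGen (S : Finset ℤ) (lam : Module.Dual ℂ H) : LS S lam :=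
  LieSubmodule.Quotient.mk' _ (vermaGen S lam)

lemma ls_cyclic : LieSubmodule.lieSpan ℂ (glS S) {lsGen S lam} = ⊤ := by
  refine eq_top_iff.mpr fun x _ => ?_
  obtain ⟨y, rfl⟩ := LieSubmodule.Quotient.surjective_mk' _ x
  have h : LieSubmodule.lieSpan ℂ (glS S) {vermaGen S lam} ≤
      (LieSubmodule.lieSpan ℂ (glS S) {lsGen S lam}).comap (LieSubmodule.Quotient.mk' _) := by
    rw [LieSubmodule.lieSpan_le, Set.singleton_subset_iff]
    exact LieSubmodule.subset_lieSpan (R := ℂ) (L := glS S) (Set.mem_singleton (lsGen S lam))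
  rw [verma_cyclic] at h
  exact h (LieSubmodule.mem_top y)

/-- In an irreducible module, the `gl_S`-submodule generated by a highest weight vector is a
quotient of `L(λ_S)`. -/
lemma exists_ls_hom [LieModule.IsIrreducible ℂ glInf W] {v : W} (hv : IsHighestWeight S lam v) :
    ∃ F : LS S lam →ₗ⁅ℂ,glS S⁆ W, F (lsGen S lam) = v ∧ ∀ u, F u ∈ vacuum S W := by
  obtain ⟨F, hF⟩ := exists_verma_hom hv
  let a := diagWeight S lam (fun _ => -1)
  let Y : Submodule ℂ W := vacuum S W ⊓
    (LieModule.toEnd ℂ glInf W (diag S (fun _ => -1) : glInf)).eigenspace a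
  have hY : ∀ p ∈ S, ∀ q ∈ S, ∀ w ∈ Y, ⁅E p q, w⁆ ∈ Y := by
    rintro p hp q hq w ⟨hw1, hw2⟩
    refine ⟨lie_E_mem_vacuum hw1 hp, Module.End.mem_eigenspace_iff.mpr ?_⟩
    have hw2' : ⁅(diag S (fun _ => -1) : glInf), w⁆ = a • w := Module.End.mem_eigenspace_iff.mp hw2
    change ⁅(diag S (fun _ => -1) : glInf), ⁅E p q, w⁆⁆ = a • ⁅E p q, w⁆
    rw [leibniz_lie, lie_diag_E, if_pos hp, if_pos hq, hw2', lie_smul]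
    simp
  have hvY : v ∈ Y := ⟨hv.outside, Module.End.mem_eigenspace_iff.mpr
    (lie_diag_of_weight hv.weight _)⟩
  have hFY (x : Verma S lam) : F x ∈ Y := by
    let N : LieSubmodule ℂ (glS S) (Verma S lam) :=
      { Y.comap (F : Verma S lam →ₗ[ℂ] W) with
        lie_mem := fun {x m} hm => by
          change F ⁅x, m⁆ ∈ Y
          rw [LieModuleHom.map_lie]
          exact lie_mem_of_lie_ES_mem hY x hm }
    have h : LieSubmodule.lieSpan ℂ (glS S) {vermaGen S lam} ≤ N := by
      rw [LieSubmodule.lieSpan_le, Set.singleton_subset_iff]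
      change F _ ∈ Y
      rwa [hF]
    rw [verma_cyclic] at h
    exact h (LieSubmodule.mem_top x)
  set K := sSup {N : LieSubmodule ℂ (glS S) (Verma S lam) | N ≠ ⊤} with hK
  have hKF : ∀ x ∈ K, F x = 0 := by
    intro x hx
    by_contra h0
    -- If F(K) were nonzero it would contain v, by simplicity of the top level. But K lies strictly
    -- above the highest weight line in the finer grading by i, so v would vanish.
    have hvP := mem_of_glS_stable (W := W) (S := S) (a := a)
      (P := K.toSubmodule.map (F : Verma S lam →ₗ[ℂ] W))
      (by rintro _ ⟨y, _, rfl⟩; exact (hFY y).1)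
      (by
        rintro p hp q hq _ ⟨y, hy, rfl⟩
        refine ⟨⁅ES hp hq, y⁆, K.lie_mem hy, ?_⟩
        exact F.map_lie _ _)
      (by rintro _ ⟨y, _, rfl⟩; exact Module.End.mem_eigenspace_iff.mp (hFY y).2)
      ⟨x, hx, rfl⟩ h0 (Module.End.mem_eigenspace_iff.mp hvY.2)
    obtain ⟨y, hy, hyv⟩ := hvP
    have hg := verma_isGradedCyclic S lam 0
    refine hv.ne_zero (eq_zero_of_mem_above (diag S (· - 0)) (diagWeight S lam (· - 0)) ?_ ?_)
    · exact lie_diag_of_weight hv.weight _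
    · rw [← hyv]
      exact map_mem_above F _ _ (hg.sSup_le_above hy)
  let G : (Verma S lam ⧸ K.toSubmodule) →ₗ[ℂ] W := K.toSubmodule.liftQ (F : Verma S lam →ₗ[ℂ] W) hKF
  refine ⟨{ toFun := G, map_add' := G.map_add, map_smul' := G.map_smul, map_lie' := ?_ }, hF, ?_⟩
  · intro x m
    obtain ⟨m, rfl⟩ := LieSubmodule.Quotient.surjective_mk' K m
    exact F.map_lie x m
  · intro u
    obtain ⟨m, rfl⟩ := LieSubmodule.Quotient.surjective_mk' K u
    exact (hFY m).1

end VermaModule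

/-! ### Generalized Verma modules -/

section GeneralizedVerma

variable (S : Finset ℤ) (lam : Module.Dual ℂ H)

/-- The quotient map onto the generalized Verma module. -/
def genVermaMk (t : UniversalEnvelopingAlgebra ℂ glInf ⊗[ℂ] LS S lam) : GenVerma S (LS S lam) :=
  Submodule.Quotient.mk (p := genVermaRel S (LS S lam)) t

lemma genVermaMk_add (s t : UniversalEnvelopingAlgebra ℂ glInf ⊗[ℂ] LS S lam) :
    genVermaMk S lam (s + t) = genVermaMk S lam s + genVermaMk S lam t := rfl

lemma genVermaMk_zero : genVermaMk S lam 0 = 0 := rfl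

lemma genVermaMk_smul (c : ℂ) (t : UniversalEnvelopingAlgebra ℂ glInf ⊗[ℂ] LS S lam) :
    genVermaMk S lam (c • t) = c • genVermaMk S lam t := rfl

/-- The highest weight vector of `M(S, L(λ_S))`. -/
def genVermaGen : GenVerma S (LS S lam) :=
  genVermaMk S lam (1 ⊗ₜ lsGen S lam)

lemma smul_mk_one_tmul (a : UniversalEnvelopingAlgebra ℂ glInf) (u : LS S lam) :
    a • genVermaMk S lam (1 ⊗ₜ u) = genVermaMk S lam (a ⊗ₜ u) := by
  change genVermaMk S lam (a • (1 ⊗ₜ u)) = _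
  rw [TensorProduct.smul_tmul', smul_eq_mul, mul_one]

lemma lie_mk_one_tmul (x : glS S) (u : LS S lam) :
    ⁅(x : glInf), genVermaMk S lam (1 ⊗ₜ u)⁆ =
      genVermaMk S lam (1 ⊗ₜ ⁅x, u⁆) := by
  refine (smul_mk_one_tmul S lam _ u).trans ((Submodule.Quotient.eq _).mpr ?_)
  exact Submodule.subset_span (.inl ⟨x, u, rfl⟩)

lemma lie_glPlus_mk_one_tmul {x : glInf} (hx : x ∈ glPlus S) (u : LS S lam) :
    ⁅x, genVermaMk S lam (1 ⊗ₜ u)⁆ = 0 := by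
  refine (smul_mk_one_tmul S lam _ u).trans ((Submodule.Quotient.mk_eq_zero _).mpr ?_)
  exact Submodule.subset_span (.inr ⟨x, hx, u, rfl⟩)

lemma genVerma_cyclic : LieSubmodule.lieSpan ℂ glInf {genVermaGen S lam} = ⊤ := by
  set N := LieSubmodule.lieSpan ℂ glInf {genVermaGen S lam} with hN
  have h1 (u : LS S lam) : genVermaMk S lam (1 ⊗ₜ u) ∈ N := by
    let N' : LieSubmodule ℂ (glS S) (LS S lam) :=
      { carrier := {u | genVermaMk S lam (1 ⊗ₜ u) ∈ N}
        add_mem' := fun {u w} hu hw => by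
          change genVermaMk S lam (1 ⊗ₜ (u + w)) ∈ N
          rw [TensorProduct.tmul_add, genVermaMk_add]
          exact add_mem hu hw
        zero_mem' := by
          change genVermaMk S lam (1 ⊗ₜ 0) ∈ N
          rw [TensorProduct.tmul_zero, genVermaMk_zero]
          exact zero_mem N
        smul_mem' := fun c u hu => by
          change genVermaMk S lam (1 ⊗ₜ (c • u)) ∈ N
          rw [TensorProduct.tmul_smul, genVermaMk_smul]
          exact N.smul_mem c hu
        lie_mem := fun {x u} hu => by
          change genVermaMk S lam (1 ⊗ₜ ⁅x, u⁆) ∈ N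
          rw [← lie_mk_one_tmul]
          exact N.lie_mem hu }
    have h : LieSubmodule.lieSpan ℂ (glS S) {lsGen S lam} ≤ N' := by
      rw [LieSubmodule.lieSpan_le, Set.singleton_subset_iff]
      exact LieSubmodule.subset_lieSpan (R := ℂ) (L := glInf)
        (Set.mem_singleton (genVermaGen S lam))
    rw [ls_cyclic] at h
    exact h (LieSubmodule.mem_top u)
  refine eq_top_iff.mpr fun x _ => ?_
  obtain ⟨t, ht⟩ := Submodule.Quotient.mk_surjective (genVermaRel S (LS S lam)) x
  change genVermaMk S lam t = x at ht
  subst ht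
  induction t using TensorProduct.induction_on with
  | zero => exact zero_mem N
  | add s t hs ht =>
    rw [genVermaMk_add]
    exact add_mem (hs trivial) (ht trivial)
  | tmul a u =>
    have h := uea_smul_mem N.toSubmodule (fun x m hm => N.lie_mem hm) a _ (h1 u)
    rw [smul_mk_one_tmul] at h
    exact h

variable {S lam}

lemma genVermaGen_isHighestWeight (h0 : genVermaGen S lam ≠ 0) :
    IsHighestWeight S lam (genVermaGen S lam) where
  ne_zero := h0
  outside m n hn := lie_glPlus_mk_one_tmul S lam (Submodule.subset_span ⟨m, n, hn, rfl⟩) _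
  upper m hm n hn h := by
    refine (lie_mk_one_tmul S lam (ES hm hn) (lsGen S lam)).trans ?_
    rw [lsGen, ← LieModuleHom.map_lie, lie_ES_vermaGen_of_lt lam hm hn h, map_zero,
      TensorProduct.tmul_zero, genVermaMk_zero]
  weight i hi := by
    refine (lie_mk_one_tmul S lam (ES hi hi) (lsGen S lam)).trans ?_
    rw [lsGen, ← LieModuleHom.map_lie, lie_ES_vermaGen_self, map_smul, TensorProduct.tmul_smul, genVermaMk_smul]
    rfl

variable {W : Type*} [AddCommGroup W] [Module ℂ W] [LieRingModule glInf W] [LieModule ℂ glInf W]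

lemma exists_genVerma_hom [LieModule.IsIrreducible ℂ glInf W] {v : W}
    (hv : IsHighestWeight S lam v) :
    ∃ F : GenVerma S (LS S lam) →ₗ⁅ℂ,glInf⁆ W, F (genVermaGen S lam) = v := by
  obtain ⟨φ, hφ, hvac⟩ := exists_ls_hom hv
  let ψ : UniversalEnvelopingAlgebra ℂ glInf ⊗[ℂ] LS S lam →ₗ[ℂ] W :=
    TensorProduct.lift
      (LinearMap.lcomp ℂ W (φ : LS S lam →ₗ[ℂ] W) ∘ₗ (ueaAction glInf W).toLinearMap)
  have hψ (a u) : ψ (a ⊗ₜ u) = ueaAction glInf W a (φ u) := rfl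
  obtain ⟨F, h1, h2⟩ := exists_map_quotient_span (g := glInf)
    ({a | ∃ (x : glS S) (u : LS S lam),
        a = UniversalEnvelopingAlgebra.ι ℂ (x : glInf) ⊗ₜ[ℂ] u - 1 ⊗ₜ[ℂ] ⁅x, u⁆} ∪
     {a | ∃ x ∈ glPlus S, ∃ u : LS S lam, a = UniversalEnvelopingAlgebra.ι ℂ x ⊗ₜ[ℂ] u}) ψ
    (fun x y => by
      induction y using TensorProduct.induction_on with
      | zero => simp
      | add s t hs ht => rw [smul_add, map_add, hs, ht, map_add, lie_add]
      | tmul a u =>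
        rw [TensorProduct.smul_tmul', hψ, hψ, smul_eq_mul, map_mul, Module.End.mul_apply,
          ueaAction_ι]) (by
      rintro _ (⟨x, u, rfl⟩ | ⟨x, hx, u, rfl⟩)
      · rw [map_sub, hψ, hψ, ueaAction_ι, map_one, Module.End.one_apply, LieModuleHom.map_lie]
        exact sub_self _
      · rw [hψ, ueaAction_ι]
        exact lie_glPlus_eq_zero (hvac u) hx)
  refine ⟨{ toFun := F, map_add' := F.map_add, map_smul' := F.map_smul, map_lie' := h2 _ _ }, ?_⟩
  refine (h1 (1 ⊗ₜ lsGen S lam)).trans ?_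
  rw [hψ, map_one, Module.End.one_apply, hφ]

lemma IsHighestWeight.exists_isGradedCyclic {v : W} (hv : IsHighestWeight S lam v)
    (hgen : LieSubmodule.lieSpan ℂ glInf {v} = ⊤) :
    ∃ (deg : ℤ × ℤ → ℤ) (D : glInf) (a : ℂ),
      IsGradedCyclic (fun p : ℤ × ℤ => E p.1 p.2) deg D a v := by
  obtain ⟨N, hN⟩ : ∃ N : ℤ, ∀ i ∈ S, i < N := by
    obtain ⟨B, hB⟩ := S.bddAbove
    exact ⟨B + 1, fun i hi => Int.lt_add_one_of_le (hB hi)⟩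
  exact ⟨_, _, _, hv.isGradedCyclic hN hgen⟩

/-- The generator maps to v ≠ 0; this is how nonvanishing of the generalized Verma module is
obtained without PBW. -/
lemma IsHighestWeight.genVermaGen_ne_zero [LieModule.IsIrreducible ℂ glInf W] {v : W}
    (hv : IsHighestWeight S lam v) : genVermaGen S lam ≠ 0 := by
  obtain ⟨F, hF⟩ := exists_genVerma_hom hv
  exact fun h => hv.ne_zero (by rw [← hF, h, map_zero])

lemma isIrreducible_L_of_ne_zero (h0 : genVermaGen S lam ≠ 0) :
    LieModule.IsIrreducible ℂ glInf (L S lam) := by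
  obtain ⟨deg, D, a, hg⟩ :=
    (genVermaGen_isHighestWeight h0).exists_isGradedCyclic (genVerma_cyclic S lam)
  exact hg.isIrreducible h0

/-- An irreducible module with a highest weight vector of weight `λ` is `L(S, λ)`. -/
theorem IsHighestWeight.nonempty_equiv_L [LieModule.IsIrreducible ℂ glInf W] {v : W}
    (hv : IsHighestWeight S lam v) : Nonempty (W ≃ₗ⁅ℂ,glInf⁆ L S lam) := by
  obtain ⟨F, hF⟩ := exists_genVerma_hom hv
  obtain ⟨deg, D, a, hg⟩ := (genVermaGen_isHighestWeight
    hv.genVermaGen_ne_zero).exists_isGradedCyclic (genVerma_cyclic S lam)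
  exact hg.nonempty_equiv F (hF ▸ hv.ne_zero)

end GeneralizedVerma

/-! ### Highest weight vectors of modules in `𝒞_int` -/

section Functional

attribute [local instance 100] LieRing.ofAssociativeRing

/-- The linear form on `H` with value `a i` on `E_{i,i}` for `i ∈ S` and zero on the others. -/
def diagForm (S : Finset ℤ) (a : ℤ → ℕ) : Module.Dual ℂ H :=
  ∑ i ∈ S, (a i : ℂ) • ((Finsupp.lapply i : CInf →ₗ[ℂ] ℂ) ∘ₗ
    LinearMap.applyₗ (Finsupp.single i 1) ∘ₗ glInf.toSubmodule.subtype ∘ₗ H.subtype)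

lemma diagForm_EH (S : Finset ℤ) (a : ℤ → ℕ) (j : ℤ) :
    diagForm S a (EH j) = if j ∈ S then (a j : ℂ) else 0 := by
  have h (i : ℤ) : matUnit j j (Finsupp.single i 1) i = if i = j then 1 else 0 := by
    by_cases h : i = j
    · simp [matUnit, h]
    · simp [matUnit, h]
  simp only [diagForm, LinearMap.sum_apply, LinearMap.smul_apply, smul_eq_mul]
  rw [← Finset.sum_ite_eq' S j fun i => (a i : ℂ)]
  refine Finset.sum_congr rfl fun i _ => ?_
  refine (congrArg _ (h i)).trans ?_
  rw [mul_ite, mul_one, mul_zero]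

lemma E_ne_zero (m n : ℤ) : E m n ≠ 0 := by
  intro h
  have h1 : matUnit m n (Finsupp.single n 1) m = 0 := by
    have h2 : matUnit m n = 0 := congrArg Subtype.val h
    rw [h2]
    rfl
  simp [matUnit] at h1

lemma isSl2Triple_E {m p : ℤ} (h : m ≠ p) :
    IsSl2Triple (E m m - E p p) (E m p) (E p m) where
  h_ne_zero h0 := by
    have h1 : ⁅E m m - E p p, E m p⁆ = 0 := by rw [h0, zero_lie]
    rw [sub_lie, lie_E, lie_E] at h1
    simp only [if_true, h, h.symm, if_false, sub_zero, zero_sub, sub_neg_eq_add] at h1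
    rw [← two_smul ℂ] at h1
    exact E_ne_zero m p ((smul_eq_zero.mp h1).resolve_left two_ne_zero)
  lie_e_f := by rw [lie_E]; simp
  lie_h_e_nsmul := by
    rw [sub_lie, lie_E, lie_E, two_nsmul]
    simp [h, h.symm]
  lie_h_f_nsmul := by
    rw [sub_lie, lie_E, lie_E, two_nsmul]
    simp only [if_true, h, h.symm, if_false]
    abel

end Functional

/-! ### Dominant weights from integrability -/

section Integrable

variable {W : Type*} [AddCommGroup W] [Module ℂ W] [LieRingModule glInf W] [LieModule ℂ glInf W]

lemma IsIntegrable.weight_sub_nat (h : IsIntegrable W) {m p : ℤ} (hmp : m ≠ p) {w : W}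
    (h0 : w ≠ 0) {μ ν : ℂ} (hm : ⁅E m m, w⁆ = μ • w) (hp : ⁅E p p, w⁆ = ν • w)
    (he : ⁅E m p, w⁆ = 0) : ∃ k : ℕ, μ - ν = k :=
  primitive_weight_nat (isSl2Triple_E hmp)
    { ne_zero := h0, lie_h := by rw [sub_lie, hm, hp, sub_smul], lie_e := he }
    (h.locallyNilpotent p m hmp.symm w)

lemma IsIntegrable.exists_joint_eigenvector (h : IsIntegrable W) {S : Finset ℤ} {w : W}
    (hw : w ∈ vacuum S W) (h0 : w ≠ 0) (T : Finset ℤ) (hT : T ⊆ S) :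
    ∃ (μ : ℤ → ℂ), ∃ y ∈ vacuum S W, y ≠ 0 ∧ ∀ i ∈ T, ⁅E i i, y⁆ = μ i • y := by
  induction T using Finset.induction_on with
  | empty => exact ⟨0, w, hw, h0, by simp⟩
  | insert j T hj ih =>
    obtain ⟨μ, y, hy, hy0, hyT⟩ := ih ((Finset.subset_insert _ _).trans hT)
    have hjS : j ∈ S := hT (Finset.mem_insert_self _ _)
    let P : Submodule ℂ W := vacuum S W ⊓
      ⨅ i ∈ T, (LieModule.toEnd ℂ glInf W (E i i)).eigenspace (μ i)
    have hP (x : W) : x ∈ P ↔ x ∈ vacuum S W ∧ ∀ i ∈ T, ⁅E i i, x⁆ = μ i • x := by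
      simp only [P, Submodule.mem_inf, Submodule.mem_iInf, Module.End.mem_eigenspace_iff,
        LieModule.toEnd_apply_apply]
    obtain ⟨ν, z, hz, hz0, hzj⟩ := exists_eigenvector_mem _ (h.semisimple j) P (by
      intro x hx
      rw [hP] at hx ⊢
      refine ⟨lie_E_mem_vacuum hx.1 hjS, fun i hi => ?_⟩
      have hij : i ≠ j := fun h => hj (h ▸ hi)
      change ⁅E i i, ⁅E j j, x⁆⁆ = μ i • ⁅E j j, x⁆
      rw [leibniz_lie, lie_E, if_neg hij, if_neg hij, sub_zero, zero_lie, zero_add, hx.2 i hi,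
        lie_smul]) ((hP y).mpr ⟨hy, hyT⟩) hy0
    refine ⟨Function.update μ j ν, z, ((hP z).mp hz).1, hz0, fun i hi => ?_⟩
    rcases Finset.mem_insert.mp hi with rfl | hi
    · rw [Function.update_self]
      exact hzj
    · rw [Function.update_of_ne (fun h : i = j => hj (h ▸ hi))]
      exact ((hP z).mp hz).2 i hi

/-- For p ∉ S both `E p p` and `E i p` kill w, so w is primitive for the sl_2 of the indices i and
p, with weight μ i - 0. -/
lemma IsIntegrable.exists_nat_weight (h : IsIntegrable W) {S : Finset ℤ} {w : W}
    (hw : w ∈ vacuum S W) (h0 : w ≠ 0) {μ : ℤ → ℂ} (hμ : ∀ i ∈ S, ⁅E i i, w⁆ = μ i • w) :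
    ∃ a : ℤ → ℕ, ∀ i ∈ S, μ i = a i := by
  obtain ⟨p, hp⟩ := Infinite.exists_notMem_finset S
  have h1 (i : ℤ) : ∃ k : ℕ, i ∈ S → μ i = k := by
    by_cases hi : i ∈ S
    · obtain ⟨k, hk⟩ := h.weight_sub_nat (fun h : i = p => hp (h ▸ hi)) h0 (hμ i hi)
        (show ⁅E p p, w⁆ = (0 : ℂ) • w by rw [hw p p hp, zero_smul]) (hw i p hp)
      exact ⟨k, fun _ => by rw [← hk, sub_zero]⟩
    · exact ⟨0, fun h => absurd h hi⟩
  choose a ha using h1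
  exact ⟨a, fun i hi => ha i hi⟩

/-- The nonzero vacuum space of an integrable module contains a highest weight vector. -/
lemma IsIntegrable.exists_isHighestWeight (h : IsIntegrable W) {S : Finset ℤ} {w : W}
    (hw : w ∈ vacuum S W) (h0 : w ≠ 0) :
    ∃ lam ∈ PPlus S, ∃ v : W, IsHighestWeight S lam v := by
  obtain ⟨r, hr⟩ := S.bddBelow
  let J : Set (ℤ → ℕ) := {a | ∃ y ∈ vacuum S W, y ≠ 0 ∧ ∀ i ∈ S, ⁅E i i, y⁆ = (a i : ℂ) • y}
  -- The lower bound r makes the coefficients nonnegative, so size is natural-valued on weights.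
  -- Applying `E m n` moves one unit of weight from n to m and changes size by m - n, which is
  -- negative for m < n.
  let size : (ℤ → ℕ) → ℕ := fun a => ∑ i ∈ S, (i - r).toNat * a i
  have hsize (a : ℤ → ℕ) : (size a : ℤ) = ∑ i ∈ S, (i - r) * a i := by
    simp only [size]
    push_cast
    exact Finset.sum_congr rfl fun i hi => by rw [Int.toNat_of_nonneg (sub_nonneg.mpr (hr hi))]
  have hJ : J.Nonempty := by
    obtain ⟨μ, y, hy, hy0, hyS⟩ := h.exists_joint_eigenvector hw h0 S subset_rfl
    obtain ⟨a, ha⟩ := h.exists_nat_weight hy hy0 hyS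
    exact ⟨a, y, hy, hy0, fun i hi => by rw [hyS i hi, ha i hi]⟩
  obtain ⟨a, ⟨v, hv, hv0, hvS⟩, hmin⟩ := (measure size).wf.has_min J hJ
  have hupper : ∀ m ∈ S, ∀ n ∈ S, m < n → ⁅E m n, v⁆ = 0 := by
    intro m hm n hn hmn
    by_contra hne
    have hz := lie_E_mem_vacuum hv hm (q := n)
    have hwt : ∀ i ∈ S, ⁅E i i, ⁅E m n, v⁆⁆ =
        ((a i : ℂ) + (if i = m then 1 else 0) - (if i = n then 1 else 0)) • ⁅E m n, v⁆ := by
      intro i hi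
      have h1 : ⁅E i i, E m n⁆ =
          ((if i = m then (1 : ℂ) else 0) - (if i = n then 1 else 0)) • E m n := by
        rw [lie_E, sub_smul]
        congr 1 <;> split_ifs with h₁ <;> simp [h₁]
      rw [leibniz_lie, h1, hvS i hi, lie_smul, smul_lie, ← add_smul]
      congr 1
      ring
    obtain ⟨b, hb⟩ := h.exists_nat_weight hz hne hwt
    refine hmin b ⟨_, hz, hne, fun i hi => by rw [hwt i hi, hb i hi]⟩ ?_
    change size b < size a
    have hb' : ∀ i ∈ S, (b i : ℤ) = a i + (if i = m then 1 else 0) - (if i = n then 1 else 0) := by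
      intro i hi
      have := hb i hi
      have h2 : (((a i : ℤ) + (if i = m then 1 else 0) - (if i = n then 1 else 0) : ℤ) : ℂ) =
          ((b i : ℤ) : ℂ) := by
        push_cast
        exact this
      exact (Int.cast_injective h2).symm
    have h3 : (size b : ℤ) = size a + (m - n) := by
      rw [hsize, hsize, Finset.sum_congr rfl fun i hi => by rw [hb' i hi]]
      simp only [mul_sub, mul_add, Finset.sum_sub_distrib, Finset.sum_add_distrib, mul_ite, mul_one,
        mul_zero, Finset.sum_ite_eq', hm, hn, if_true]
      ring
    omega
  refine ⟨diagForm S a, ⟨fun i => if i ∈ S then a i else 0, fun i => ?_, fun i hi => if_neg hi, ?_⟩,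
    v, hv0, hv, hupper, fun i hi => ?_⟩
  · rw [diagForm_EH]
    by_cases hi : i ∈ S <;> simp [hi]
  · intro i hi j hj hij
    obtain ⟨k, hk⟩ := h.weight_sub_nat hij.ne hv0 (hvS i hi) (hvS j hj) (hupper i hi j hj hij)
    have hk' : (a i : ℂ) = ((k + a j : ℕ) : ℂ) := by
      push_cast
      rw [← hk, sub_add_cancel]
    have := Nat.cast_injective hk'
    simp only [hi, hj, if_true]
    omega
  · rw [diagForm_EH, if_pos hi, hvS i hi]

lemma InCint.exists_isHighestWeight [Nontrivial W] (h : InCint W) :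
    ∃ r n : ℤ, r < n ∧ ∃ lam ∈ PPlus (Finset.Icc r n), ∃ v : W,
      IsHighestWeight (Finset.Icc r n) lam v := by
  obtain ⟨w, hw⟩ := exists_ne (0 : W)
  obtain ⟨T, hT⟩ := h.inC w
  obtain ⟨r, hr⟩ := T.bddBelow
  obtain ⟨n, hn⟩ := T.bddAbove
  -- The maximum with r + 1 forces the interval to have at least two points, even when T has one or
  -- none.
  have hsub : T ⊆ Finset.Icc r (max n (r + 1)) := fun i hi =>
    Finset.mem_Icc.mpr ⟨hr hi, le_max_of_le_left (hn hi)⟩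
  obtain ⟨lam, hlam, v, hv⟩ := h.integrable.exists_isHighestWeight
    (S := Finset.Icc r (max n (r + 1))) (w := w) (fun m k hk => hT m k fun hkT => hk (hsub hkT)) hw
  exact ⟨r, _, lt_max_of_lt_right (lt_add_one r), lam, hlam, v, hv⟩

end Integrable

/-! ### Derivations of products and determinants -/

section Derivations

variable {R A : Type*} [CommRing R] [CommRing A] [Algebra R A] (d : Derivation R A A)

lemma derivation_prod {ι : Type*} [DecidableEq ι] (s : Finset ι) (f : ι → A) :
    d (∏ i ∈ s, f i) = ∑ i ∈ s, ∏ k ∈ s, if k = i then d (f k) else f k := by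
  induction s using Finset.induction_on with
  | empty => simp
  | insert j s hj ih =>
    have h1 : ∏ k ∈ s, (if k = j then d (f k) else f k) = ∏ k ∈ s, f k :=
      Finset.prod_congr rfl fun k hk => if_neg fun h : k = j => hj (h ▸ hk)
    rw [Finset.prod_insert hj, Derivation.leibniz, ih, Finset.sum_insert hj,
      Finset.prod_insert hj, if_pos rfl, h1, add_comm, smul_eq_mul, mul_comm, smul_eq_mul,
      Finset.mul_sum]
    congr 1
    refine Finset.sum_congr rfl fun i hi => ?_
    rw [Finset.prod_insert hj, if_neg (show ¬j = i from fun h => hj (h ▸ hi))]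

lemma derivation_det {κ : Type*} [Fintype κ] [DecidableEq κ] (M : Matrix κ κ A) :
    d M.det = ∑ q, (M.updateCol q fun p => d (M p q)).det := by
  simp only [Matrix.det_apply, map_sum]
  rw [Finset.sum_comm]
  refine Finset.sum_congr rfl fun σ _ => ?_
  rw [Units.smul_def, ← Derivation.coeFn_coe, map_zsmul, Derivation.coeFn_coe, derivation_prod,
    Finset.smul_sum]
  refine Finset.sum_congr rfl fun q _ => ?_
  rw [Units.smul_def]
  congr 1
  refine Finset.prod_congr rfl fun k _ => ?_
  by_cases h : k = q
  · subst h; simp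
  · simp [h]

variable {d}

lemma derivation_pow_eq_smul {f : A} {c : R} (hf : d f = c • f) (k : ℕ) :
    d (f ^ k) = ((k : R) * c) • f ^ k := by
  induction k with
  | zero => simp
  | succ k ih =>
    rw [pow_succ, Derivation.leibniz, ih, hf]
    simp only [smul_eq_mul, Algebra.smul_def, map_mul, map_natCast, Nat.cast_add, Nat.cast_one,
      map_add, map_one]
    ring

lemma derivation_prod_eq_smul {ι : Type*} (s : Finset ι) {f : ι → A} {c : ι → R}
    (hf : ∀ i ∈ s, d (f i) = c i • f i) :
    d (∏ i ∈ s, f i) = (∑ i ∈ s, c i) • ∏ i ∈ s, f i := by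
  classical
  induction s using Finset.induction_on with
  | empty => simp
  | insert j s hj ih =>
    rw [Finset.prod_insert hj, Derivation.leibniz, ih fun i hi => hf i (Finset.mem_insert_of_mem hi),
      hf j (Finset.mem_insert_self _ _), Finset.sum_insert hj]
    simp only [smul_eq_mul, Algebra.smul_def, map_add]
    ring

lemma derivation_pow_mul_const {z : A} (hz : d z = 0) (k : ℕ) (f : A) :
    ((d : A →ₗ[R] A) ^ k) (f * z) = ((d : A →ₗ[R] A) ^ k) f * z := by
  induction k with
  | zero => simp
  | succ k ih =>
    rw [pow_succ', Module.End.mul_apply, ih, Module.End.mul_apply, Derivation.coeFn_coe,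
      Derivation.leibniz, hz]
    simp [mul_comm]

/-- In the Leibniz expansion of d^{k+1}(f y) only terms with at most one derivative on y survive,
and these contain d^{k+1} f or d^k f. Local nilpotency thus passes from f to f times a variable. -/
lemma derivation_pow_succ_mul {y : A} (hy : d (d y) = 0) (k : ℕ) (f : A)
    (hf : ((d : A →ₗ[R] A) ^ k) f = 0) : ((d : A →ₗ[R] A) ^ (k + 1)) (f * y) = 0 := by
  induction k generalizing f with
  | zero =>
    have : f = 0 := by simpa using hf
    simp [this]
  | succ k ih =>
    have h1 : (d : A →ₗ[R] A) (f * y) = d f * y + f * d y := by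
      rw [Derivation.coeFn_coe, Derivation.leibniz, smul_eq_mul, smul_eq_mul]
      ring
    rw [pow_succ, Module.End.mul_apply, h1, map_add, derivation_pow_mul_const hy, hf, zero_mul,
      add_zero]
    refine ih (d f) ?_
    rw [pow_succ, Module.End.mul_apply] at hf
    exact hf

end Derivations

/-! ### The action of `gl_∞` on polynomials in a matrix of variables -/

section PolynomialModule

attribute [local instance 100] LieRing.ofAssociativeRing

open MvPolynomial

/-- Polynomials in the entries of a doubly infinite matrix of variables. -/
abbrev MatPoly : Type := MvPolynomial (ℤ × ℤ) ℂ

/-- The embedding of `ℂ^∞` as the linear forms in the `j`-th column of variables. -/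
def columnForm (j : ℤ) : CInf →ₗ[ℂ] MatPoly :=
  Finsupp.linearCombination ℂ fun m => (X (m, j) : MatPoly)

lemma columnForm_single (i j : ℤ) : columnForm j (Finsupp.single i 1) = X (i, j) := by
  simp [columnForm]

/-- The derivation by which an element of `gl_∞` acts on polynomials. -/
def matDer (x : glInf) : Derivation ℂ MatPoly MatPoly :=
  mkDerivation ℂ fun p => columnForm p.2 ((x : Module.End ℂ CInf) (Finsupp.single p.1 1))

lemma matDer_X (x : glInf) (i j : ℤ) : matDer x (X (i, j)) =
    columnForm j ((x : Module.End ℂ CInf) (Finsupp.single i 1)) := mkDerivation_X _ _ _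

lemma matDer_columnForm (x : glInf) (j : ℤ) (u : CInf) :
    matDer x (columnForm j u) = columnForm j ((x : Module.End ℂ CInf) u) := by
  have h : (matDer x : MatPoly →ₗ[ℂ] MatPoly) ∘ₗ columnForm j =
      columnForm j ∘ₗ (x : Module.End ℂ CInf) := by
    refine Finsupp.lhom_ext' fun i => LinearMap.ext_ring ?_
    change matDer x (columnForm j (Finsupp.single i 1)) =
      columnForm j ((x : Module.End ℂ CInf) (Finsupp.single i 1))
    rw [columnForm_single, matDer_X]
  exact LinearMap.congr_fun h u

lemma matDer_add (x y : glInf) : matDer (x + y) = matDer x + matDer y := by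
  refine derivation_ext fun ⟨i, j⟩ => ?_
  rw [Derivation.add_apply, matDer_X, matDer_X, matDer_X, ← map_add]
  rfl

lemma matDer_smul (c : ℂ) (x : glInf) : matDer (c • x) = c • matDer x := by
  refine derivation_ext fun ⟨i, j⟩ => ?_
  rw [Derivation.smul_apply, matDer_X, matDer_X, ← map_smul]
  rfl

lemma matDer_lie (x y : glInf) : matDer ⁅x, y⁆ = ⁅matDer x, matDer y⁆ := by
  refine derivation_ext fun ⟨i, j⟩ => ?_
  rw [Derivation.commutator_apply, matDer_X, matDer_X, matDer_X, matDer_columnForm,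
    matDer_columnForm, ← map_sub]
  rfl

instance : LieRingModule glInf MatPoly where
  bracket x f := matDer x f
  add_lie x y f := by
    change matDer (x + y) f = matDer x f + matDer y f
    rw [matDer_add, Derivation.add_apply]
  lie_add x f g := (matDer x).map_add f g
  leibniz_lie x y f := by
    change matDer x (matDer y f) = matDer ⁅x, y⁆ f + matDer y (matDer x f)
    rw [matDer_lie, Derivation.commutator_apply, sub_add_cancel]

instance : LieModule ℂ glInf MatPoly where
  smul_lie c x f := by
    change matDer (c • x) f = c • matDer x f
    rw [matDer_smul, Derivation.smul_apply]
  lie_smul c x f := (matDer x).map_smul c f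

lemma lie_matPoly (x : glInf) (f : MatPoly) : ⁅x, f⁆ = matDer x f := rfl

lemma matDer_E_X (m n i j : ℤ) :
    matDer (E m n) (X (i, j)) = if i = n then X (m, j) else 0 := by
  rw [matDer_X]
  change columnForm j (matUnit m n (Finsupp.single i 1)) = _
  by_cases h : i = n
  · simp [matUnit, h, columnForm_single]
  · simp [matUnit, h]

lemma inCint_matPoly : InCint MatPoly where
  inC f := by
    refine ⟨f.vars.image Prod.fst, fun m n hn => ?_⟩
    refine derivation_eq_zero_of_forall_mem_vars (D := matDer (E m n)) ?_
    rintro ⟨i, j⟩ hij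
    rw [matDer_E_X, if_neg]
    rintro rfl
    exact hn (Finset.mem_image_of_mem Prod.fst hij)
  integrable :=
    { semisimple := fun n => by
        -- `E n n` counts the degree in the variables X (n, j), so monomials are eigenvectors.
        have h (s : ℤ × ℤ →₀ ℕ) (a : ℂ) :
            ∃ μ : ℂ, matDer (E n n) (monomial s a) = μ • monomial s a := by
          refine induction_on_monomial (motive := fun p => ∃ μ : ℂ, matDer (E n n) p = μ • p)
            (fun a => ⟨0, by rw [zero_smul, ← algebraMap_eq, Derivation.map_algebraMap]⟩) ?_ s a
          rintro p ⟨i, j⟩ ⟨μ, hμ⟩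
          refine ⟨μ + (if i = n then 1 else 0), ?_⟩
          rw [Derivation.leibniz, hμ, matDer_E_X, smul_eq_mul, smul_eq_mul, add_smul,
            mul_smul_comm, mul_comm, add_comm, mul_comm]
          congr 1
          split_ifs with h
          · rw [h, one_smul, mul_comm]
          · simp
        refine eq_top_iff.mpr fun f _ => ?_
        induction f using MvPolynomial.induction_on' with
        | monomial s a =>
          obtain ⟨μ, hμ⟩ := h s a
          exact Submodule.mem_iSup_of_mem μ (Module.End.mem_eigenspace_iff.mpr hμ)
        | add p q hp hq => exact add_mem (hp trivial) (hq trivial)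
      locallyNilpotent := fun p q hpq f => by
        change ∃ k : ℕ, ((matDer (E p q) : MatPoly →ₗ[ℂ] MatPoly) ^ k) f = 0
        induction f using MvPolynomial.induction_on with
        | C a => exact ⟨1, by rw [pow_one, ← algebraMap_eq]; exact Derivation.map_algebraMap _ a⟩
        | add f g hf hg =>
          obtain ⟨k, hk⟩ := hf
          obtain ⟨l, hl⟩ := hg
          refine ⟨max k l, ?_⟩
          rw [map_add, Module.End.pow_map_zero_of_le (le_max_left k l) hk,
            Module.End.pow_map_zero_of_le (le_max_right k l) hl, add_zero]
        | mul_X f i hf =>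
          obtain ⟨k, hk⟩ := hf
          refine ⟨k + 1, derivation_pow_succ_mul ?_ k f hk⟩
          obtain ⟨i, j⟩ := i
          rw [matDer_E_X]
          split_ifs
          · rw [matDer_E_X, if_neg hpq]
          · exact map_zero _ }

/-! ### Leading minors and their weights -/

/-- The generic minor on the indices `r, …, i`. -/
def minorMatrix (r i : ℤ) : Matrix (Finset.Icc r i) (Finset.Icc r i) MatPoly :=
  Matrix.of fun p q => X ((q : ℤ), (p : ℤ))

lemma det_minorMatrix_ne_zero (r i : ℤ) : (minorMatrix r i).det ≠ 0 := by
  intro h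
  have h1 := congrArg (eval fun p : ℤ × ℤ => if p.2 = p.1 then (1 : ℂ) else 0) h
  rw [RingHom.map_det, map_zero] at h1
  have h2 : (eval fun p : ℤ × ℤ => if p.2 = p.1 then (1 : ℂ) else 0).mapMatrix
      (minorMatrix r i) = 1 := by
    ext p q
    change eval (fun p : ℤ × ℤ => if p.2 = p.1 then (1 : ℂ) else 0) (X ((q : ℤ), (p : ℤ))) = _
    rw [eval_X, Matrix.one_apply]
    exact if_congr Subtype.ext_iff.symm rfl rfl
  rw [h2, Matrix.det_one] at h1
  exact one_ne_zero h1

/-- The derivation replaces column n by column m and kills the other columns. For m ≠ n two columns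
agree and the determinant vanishes; for m = n it is unchanged; if n is not a column index, nothing
survives. -/
lemma matDer_det_minorMatrix (m n r i : ℤ) (hm : n ∈ Finset.Icc r i → m ∈ Finset.Icc r i) :
    matDer (E m n) (minorMatrix r i).det =
      (if m = n ∧ n ∈ Finset.Icc r i then (1 : ℂ) else 0) • (minorMatrix r i).det := by
  rw [derivation_det]
  have hcol (q : Finset.Icc r i) (hq : (q : ℤ) ≠ n) :
      ((minorMatrix r i).updateCol q fun p => matDer (E m n) (minorMatrix r i p q)).det = 0 := by
    refine Matrix.det_eq_zero_of_column_eq_zero q fun p => ?_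
    rw [Matrix.updateCol_self]
    change matDer (E m n) (X ((q : ℤ), (p : ℤ))) = 0
    rw [matDer_E_X, if_neg hq]
  by_cases hn : n ∈ Finset.Icc r i
  · rw [Finset.sum_eq_single ⟨n, hn⟩ (fun q _ hq => hcol q fun h => hq (Subtype.ext h))
      (fun h => absurd (Finset.mem_univ _) h)]
    have hval : (fun p => matDer (E m n) (minorMatrix r i p ⟨n, hn⟩)) =
        fun p => minorMatrix r i p ⟨m, hm hn⟩ := by
      funext p
      change matDer (E m n) (X (n, (p : ℤ))) = X (m, (p : ℤ))
      rw [matDer_E_X, if_pos rfl]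
    rw [hval]
    by_cases hmn : m = n
    · subst hmn
      rw [Matrix.updateCol_eq_self, if_pos ⟨rfl, hn⟩, one_smul]
    · rw [Matrix.det_updateCol_eq_zero (fun h => hmn (congrArg Subtype.val h)),
        if_neg fun h => hmn h.1, zero_smul]
  · rw [if_neg fun h => hn h.2, zero_smul]
    exact Finset.sum_eq_zero fun q _ => hcol q fun h => hn (h ▸ q.2)

lemma sum_Icc_sub (a : ℤ → ℤ) (k n : ℤ) (hkn : k ≤ n) :
    ∑ i ∈ Finset.Icc k n, (a i - a (i + 1)) = a k - a (n + 1) := by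
  induction n, hkn using Int.leInduction with
  | base => simp
  | succ n hkn ih =>
    have h : Finset.Icc k (n + 1) = insert (n + 1) (Finset.Icc k n) := by
      ext x
      simp only [Finset.mem_Icc, Finset.mem_insert]
      omega
    rw [h, Finset.sum_insert (by simp), ih]
    ring

/-- The product of powers of leading minors of weight `a`. -/
def minorProduct (r n : ℤ) (a : ℤ → ℕ) : MatPoly :=
  ∏ i ∈ Finset.Icc r n, (minorMatrix r i).det ^ (a i - a (i + 1))

lemma lie_E_minorProduct (r n : ℤ) (a : ℤ → ℕ) (p q : ℤ)
    (h : ∀ i ∈ Finset.Icc r n, q ∈ Finset.Icc r i → p ∈ Finset.Icc r i) :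
    ⁅E p q, minorProduct r n a⁆ = (∑ i ∈ Finset.Icc r n, ((a i - a (i + 1) : ℕ) : ℂ) *
      (if p = q ∧ q ∈ Finset.Icc r i then (1 : ℂ) else 0)) • minorProduct r n a := by
  rw [lie_matPoly, minorProduct]
  exact derivation_prod_eq_smul _ fun i hi =>
    derivation_pow_eq_smul (matDer_det_minorMatrix p q r i (h i hi)) _

lemma minorProduct_isHighestWeight {r n : ℤ} {lam : Module.Dual ℂ H} {a : ℤ → ℕ}
    (hlam : ∀ i, lam (EH i) = (a i : ℂ)) (hout : ∀ i, i ∉ Finset.Icc r n → a i = 0)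
    (hanti : ∀ i ∈ Finset.Icc r n, ∀ j ∈ Finset.Icc r n, i < j → a j ≤ a i) :
    IsHighestWeight (Finset.Icc r n) lam (minorProduct r n a) where
  ne_zero := Finset.prod_ne_zero_iff.mpr fun i _ => pow_ne_zero _ (det_minorMatrix_ne_zero r i)
  outside p q hq := by
    have hq' : ∀ i ∈ Finset.Icc r n, q ∉ Finset.Icc r i := by
      intro i hi hqi
      simp only [Finset.mem_Icc] at *
      omega
    rw [lie_E_minorProduct _ _ _ _ _ fun i hi h => absurd h (hq' i hi),
      Finset.sum_eq_zero fun i hi => ?_, zero_smul]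
    rw [if_neg fun h => hq' i hi h.2, mul_zero]
  upper p hp q hq hpq := by
    rw [lie_E_minorProduct _ _ _ _ _ fun i hi h => ?_, Finset.sum_eq_zero fun i hi => ?_, zero_smul]
    · rw [if_neg fun h => hpq.ne h.1, mul_zero]
    · simp only [Finset.mem_Icc] at *
      omega
  weight k hk := by
    rw [lie_E_minorProduct _ _ _ _ _ fun i _ h => h, hlam]
    congr 1
    -- Dominance makes the truncated subtraction in the exponents genuine, including at i = n, where
    -- a (n + 1) = 0.
    have h1 : ∀ i ∈ Finset.Icc r n, a (i + 1) ≤ a i := by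
      intro i hi
      by_cases hi' : i + 1 ∈ Finset.Icc r n
      · exact hanti i hi _ hi' (lt_add_one i)
      · rw [hout _ hi']
        exact Nat.zero_le _
    have h2 : Finset.Icc k n = (Finset.Icc r n).filter (k ∈ Finset.Icc r ·) := by
      ext i
      simp only [Finset.mem_Icc, Finset.mem_filter] at *
      omega
    -- Only the minors with i ≥ k involve the index k, and their exponents telescope to a k.
    have h3 : (∑ i ∈ Finset.Icc k n, ((a i : ℤ) - a (i + 1))) = a k := by
      rw [sum_Icc_sub (fun i => (a i : ℤ)) k n (Finset.mem_Icc.mp hk).2,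
        hout (n + 1) (by simp), Nat.cast_zero, sub_zero]
    rw [h2, Finset.sum_filter] at h3
    have h4 := congrArg (Int.cast : ℤ → ℂ) h3
    rw [Int.cast_natCast, Int.cast_sum] at h4
    rw [← h4]
    refine Finset.sum_congr rfl fun i hi => ?_
    rw [Nat.cast_sub (h1 i hi)]
    by_cases hki : k ∈ Finset.Icc r i
    · rw [if_pos hki, if_pos ⟨rfl, hki⟩]
      push_cast
      ring
    · rw [if_neg hki, if_neg fun h => hki h.2]
      simp

end PolynomialModule

/-! ### Irreducible subquotients generated by highest weight vectors -/

section Subquotient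

variable {W : Type*} [AddCommGroup W] [Module ℂ W] [LieRingModule glInf W] [LieModule ℂ glInf W]
variable {W' : Type*} [AddCommGroup W'] [Module ℂ W'] [LieRingModule glInf W']
  [LieModule ℂ glInf W']
variable {S : Finset ℤ} {lam : Module.Dual ℂ H}

lemma IsHighestWeight.map {v : W} (hv : IsHighestWeight S lam v) (f : W →ₗ⁅ℂ,glInf⁆ W')
    (h0 : f v ≠ 0) : IsHighestWeight S lam (f v) where
  ne_zero := h0
  outside m n hn := by rw [← LieModuleHom.map_lie, hv.outside m n hn, map_zero]
  upper m hm n hn h := by rw [← LieModuleHom.map_lie, hv.upper m hm n hn h, map_zero]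
  weight i hi := by rw [← LieModuleHom.map_lie, hv.weight i hi, map_smul]

lemma IsHighestWeight.restrict {N : LieSubmodule ℂ glInf W} {v : N}
    (hv : IsHighestWeight S lam (v : W)) : IsHighestWeight S lam v where
  ne_zero h := hv.ne_zero (congrArg Subtype.val h)
  outside m n hn := Subtype.ext (hv.outside m n hn)
  upper m hm n hn h := Subtype.ext (hv.upper m hm n hn h)
  weight i hi := Subtype.ext (hv.weight i hi)

lemma lieSpan_self_eq_top {g : Type*} [LieRing g] [LieAlgebra ℂ g] {M : Type*} [AddCommGroup M]
    [Module ℂ M] [LieRingModule g M] [LieModule ℂ g M] (v : M) :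
    LieSubmodule.lieSpan ℂ g {(⟨v, LieSubmodule.subset_lieSpan rfl⟩ :
      LieSubmodule.lieSpan ℂ g {v})} = ⊤ := by
  set N := LieSubmodule.lieSpan ℂ g {v}
  set v' : N := ⟨v, LieSubmodule.subset_lieSpan rfl⟩
  refine eq_top_iff.mpr fun x _ => ?_
  have h : N ≤ (LieSubmodule.lieSpan ℂ g {v'}).map N.incl := by
    refine LieSubmodule.lieSpan_le.mpr (Set.singleton_subset_iff.mpr ?_)
    exact (LieSubmodule.mem_map _).mpr ⟨v', LieSubmodule.subset_lieSpan rfl, rfl⟩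
  obtain ⟨y, hy, hyx⟩ := (LieSubmodule.mem_map _).mp (h x.2)
  have : y = x := Subtype.ext hyx
  exact this ▸ hy

/-- The submodule generated by v is graded cyclic, so v survives in its irreducible quotient, and
𝒞_int is closed under submodules and quotients. -/
lemma IsHighestWeight.irrQuotient_lieSpan (hW : InCint W) {v : W}
    (hv : IsHighestWeight S lam v) :
    LieModule.IsIrreducible ℂ glInf (IrrQuotient glInf (LieSubmodule.lieSpan ℂ glInf {v})) ∧
      InCint (IrrQuotient glInf (LieSubmodule.lieSpan ℂ glInf {v})) ∧
      ∃ w : IrrQuotient glInf (LieSubmodule.lieSpan ℂ glInf {v}), IsHighestWeight S lam w := by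
  set N := LieSubmodule.lieSpan ℂ glInf {v}
  let v' : N := ⟨v, LieSubmodule.subset_lieSpan rfl⟩
  have hv' : IsHighestWeight S lam v' := hv.restrict
  obtain ⟨deg, D, a, hg⟩ := hv'.exists_isGradedCyclic (lieSpan_self_eq_top v)
  exact ⟨hg.isIrreducible hv'.ne_zero,
    (hW.lieSubmodule N).of_surjective _ (LieSubmodule.Quotient.surjective_mk' _), _,
    hv'.map (LieSubmodule.Quotient.mk' (sSup {K : LieSubmodule ℂ glInf N | K ≠ ⊤}))
      fun h => hg.not_mem_sSup hv'.ne_zero ((LieSubmodule.Quotient.mk_eq_zero _).mp h)⟩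

lemma InCint.of_nonempty_equiv (hW : InCint W) (h : Nonempty (W ≃ₗ⁅ℂ,glInf⁆ W')) : InCint W' :=
  h.elim fun e => hW.of_surjective e.toLieModuleHom e.toEquiv.surjective

lemma IsHighestWeight.isIrreducible_L [LieModule.IsIrreducible ℂ glInf W] {v : W}
    (hv : IsHighestWeight S lam v) : LieModule.IsIrreducible ℂ glInf (L S lam) :=
  isIrreducible_L_of_ne_zero hv.genVermaGen_ne_zero

lemma IsHighestWeight.inCint_L [LieModule.IsIrreducible ℂ glInf W] (hW : InCint W) {v : W}
    (hv : IsHighestWeight S lam v) : InCint (L S lam) :=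
  hW.of_nonempty_equiv hv.nonempty_equiv_L

lemma exists_irreducible_isHighestWeight {r n : ℤ} {lam : Module.Dual ℂ H}
    (hlam : lam ∈ PPlus (Finset.Icc r n)) : ∃ v : MatPoly,
    LieModule.IsIrreducible ℂ glInf (IrrQuotient glInf (LieSubmodule.lieSpan ℂ glInf {v})) ∧
      InCint (IrrQuotient glInf (LieSubmodule.lieSpan ℂ glInf {v})) ∧
      ∃ w : IrrQuotient glInf (LieSubmodule.lieSpan ℂ glInf {v}),
        IsHighestWeight (Finset.Icc r n) lam w := by
  obtain ⟨a, hlam, hout, hanti⟩ := hlam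
  exact ⟨_, (minorProduct_isHighestWeight hlam hout hanti).irrQuotient_lieSpan inCint_matPoly⟩

end Subquotient

end GlInf

end

/-! ### The classification theorem -/

theorem theorem3p21 :
    (∀ r n : ℤ, r < n → ∀ lam ∈ GlInf.PPlus (Finset.Icc r n),
      LieModule.IsIrreducible ℂ GlInf.glInf (GlInf.L (Finset.Icc r n) lam) ∧
      GlInf.InCint (GlInf.L (Finset.Icc r n) lam)) ∧
    (∀ (W : Type*) [AddCommGroup W] [Module ℂ W] [LieRingModule GlInf.glInf W]
      [LieModule ℂ GlInf.glInf W],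
      LieModule.IsIrreducible ℂ GlInf.glInf W → GlInf.InCint W →
      ∃ r n : ℤ, r < n ∧ ∃ lam ∈ GlInf.PPlus (Finset.Icc r n),
        Nonempty (W ≃ₗ⁅ℂ, GlInf.glInf⁆ GlInf.L (Finset.Icc r n) lam)) := by
  refine ⟨?_, ?_⟩
  · intro r n _ lam hlam
    exact (GlInf.exists_irreducible_isHighestWeight hlam).elim fun _ ⟨_, hC, _, hw⟩ =>
      ⟨hw.isIrreducible_L, hw.inCint_L hC⟩
  · intro W _ _ _ _ hirr hW
    have : Nontrivial W := (LieSubmodule.nontrivial_iff ℂ GlInf.glInf W).mp inferInstance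
    obtain ⟨r, n, hrn, lam, hlam, v, hv⟩ := hW.exists_isHighestWeight
    exact ⟨r, n, hrn, lam, hlam, hv.nonempty_equiv_L⟩
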